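/- Setting. Programs $P$ are finite sets of definite clauses over a first-order language containing the integers and the four arithmetic operations (integer division; division by $0$ undefined). Bodies may also contain the built-in atoms $E_1<E_2$, $E_1>E_2$, $E_1\le E_2$, $E_1\ge E_2$ and $s\;\mathit{is}\;E$. A selected comparison succeeds iff both sides are ground numerical expressions with defined values and the comparison holds; $s\;\mathit{is}\;E$ succeeds iff $E$ is such an expression and $s$ unifies with its value; otherwise a selected built-in has no descendants. LD-resolution is SLD-resolution with the leftmost selection rule; a query LD-terminates for $P$ if its LD-tree is finite. $\mathrm{Call}(P,S)$ is the set of atoms selected in LD-derivations of queries in $S$. A predicate $p$ depends on $q$ if $(p,q)$ is in the reflexive transitive closure of "some clause has $p$ in its head and $q$ in its body"; $p\simeq q$ means that each depends on the other. $P$ is acceptable with respect to a set $S$ of atomic queries if there is a level mapping $|\cdot|$ from atoms modulo renaming of variables to $\mathbb N$ such that for every $A\in\mathrm{Call}(P,S)$, every (renamed apart) clause $A'\leftarrow B_1,\dots,B_n$ of $P$ with $\theta=\mathrm{mgu}(A,A')$, every $B_i$ with $\mathrm{rel}(B_i)\simeq\mathrm{rel}(A)$, and every computed answer substitution $\sigma$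 (computed with fresh variables) of $\leftarrow(B_1,\dots,B_{i-1})\theta$, one has $|A|>|B_i\theta\sigma|$. Let $S$ be a set of atomic queries (with non-built-in predicates). Position $i$ of $p$ is an integer argument position if $t_i$ is an integer for every $p(t_1,\dots,t_n)\in\mathrm{Call}(P,S)$. A symbolic condition over the integer arguments of $p$ is a propositional formula whose atoms are comparisons between numerical expressions in the denominators $\$i$ of integer argument positions $i$ of $p$. A set of adornments for $p$ is a finite set $\mathcal A_p$ of such conditions that are pairwise contradictory and whose disjunction is valid over the integers. Let $D$ be the set of predicates mutually recursive with the predicate of some query in $S$, and let $\mathcal A_q$ be a set of adornments for each $q\in D$. The maximal prefix of a rule is the longest initial segment of its body consisting of comparisons between numerical expressions all of whose variables occur in the head. The adorned program $P^a$ consists of all clauses obtained from clauses of $P$ by replacing every occurrence, in body and head, of a predicate $q\in D$ by some $q^A$ with $A\in\mathcal A_q$ (chosen independently for each occurrence), such that the comparisons of the maximal prefix, the adornment of the head (if any) and the adornments of the body atoms, each instantiated by the arguments of its atom, are jointly satisfiable by an assignment of integers to the variables. (An argument that has no integer value under the assignment imposes no restriction.) Corollary. $P$ is LD-terminating for all queries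 in $S$ if and only if $P^a$ is acceptable with respect to $\{q^A(t_1,\dots,t_n)\mid q(t_1,\dots,t_n)\in S,\ A\in\mathcal A_q\}$. -/

import Mathlib

universe u v

namespace LP

/-! ## Terms, atoms, clauses -/

/-- A signature: symbols with arities. It is used both for the function symbols and for the
predicate symbols of a program. -/
structure Sig where
  Sym : Type u
  arity : Sym → ℕ

/-- The four operations of arithmetic. -/
inductive ArithOp
  | add | sub | mul | div

/-- The value of an operation on integers; division is integer division (truncating towards
zero) and division by zero has no value. -/
def ArithOp.eval : ArithOp → ℤ → ℤ → Option ℤ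
  | .add, a, b => some (a + b)
  | .sub, a, b => some (a - b)
  | .mul, a, b => some (a * b)
  | .div, a, b => if b = 0 then none else some (a.tdiv b)

/-- The comparison symbols `<`, `>`, `≤`, `≥`. -/
inductive CmpRel
  | lt | gt | le | ge

/-- The comparison of two integers. -/
def CmpRel.Holds : CmpRel → ℤ → ℤ → Prop
  | .lt, a, b => a < b
  | .gt, a, b => a > b
  | .le, a, b => a ≤ b
  | .ge, a, b => a ≥ b

/-- The comparison of two (possibly undefined) values: both must be defined. -/
def CmpRel.HoldsOpt (r : CmpRel) (a b : Option ℤ) : Prop :=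
  ∃ m n : ℤ, a = some m ∧ b = some n ∧ r.Holds m n

/-- First-order terms over the function symbols of `Fs`, the integer constants and the four
arithmetic function symbols; variables are natural numbers. -/
inductive Term (Fs : Sig.{u}) : Type u
  | var : ℕ → Term Fs
  | int : ℤ → Term Fs
  | arith : ArithOp → Term Fs → Term Fs → Term Fs
  | fn : (f : Fs.Sym) → (Fin (Fs.arity f) → Term Fs) → Term Fs

/-- Substitutions. -/
abbrev Subst (Fs : Sig.{u}) : Type u := ℕ → Term Fs

namespace Term

variable {Fs : Sig.{u}}

/-- The variables of a term. -/
def vars : Term Fs → Finset ℕ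
  | .var x => {x}
  | .int _ => ∅
  | .arith _ s t => s.vars ∪ t.vars
  | .fn _ ts => Finset.univ.biUnion fun i => (ts i).vars

/-- Application of a substitution. -/
def subst (θ : Subst Fs) : Term Fs → Term Fs
  | .var x => θ x
  | .int n => .int n
  | .arith o s t => .arith o (s.subst θ) (t.subst θ)
  | .fn f ts => .fn f fun i => (ts i).subst θ

/-- Numerical expressions: built from integers, variables and the four operations. -/
def isExpr : Term Fs → Bool
  | .var _ => true
  | .int _ => true
  | .arith _ s t => s.isExpr && t.isExpr
  | .fn _ _ => false

/-- The integer value, if any, of a term under a partial assignment of integers to variables. -/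
def eval (ν : ℕ → Option ℤ) : Term Fs → Option ℤ
  | .var x => ν x
  | .int n => some n
  | .arith o s t => (s.eval ν).bind fun a => (t.eval ν).bind fun b => o.eval a b
  | .fn _ _ => none

/-- The integer value, if any, of a ground numerical expression. A term with a variable has
no value. -/
def value (t : Term Fs) : Option ℤ := t.eval fun _ => none

end Term

/-- Composition: first `σ`, then `τ`. -/
def Subst.comp {Fs : Sig.{u}} (σ τ : Subst Fs) : Subst Fs := fun x => (σ x).subst τ

/-- A permutation of the variables, as a substitution. -/
def Subst.ofPerm {Fs : Sig.{u}} (π : Equiv.Perm ℕ) : Subst Fs := fun x => .var (π x)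

/-- `θ` is an (idempotent) most general solution of the unification problem `U`. -/
structure IsMGU {Fs : Sig.{u}} (U : Subst Fs → Prop) (θ : Subst Fs) : Prop where
  unifies : U θ
  most_general : ∀ τ : Subst Fs, U τ → ∃ δ : Subst Fs, τ = θ.comp δ
  idempotent : θ.comp θ = θ

/-- An atom `p(t₁,…,tₙ)` whose predicate is a predicate of the signature `Ps`, that is, not a
built-in. -/
structure UserAtom (Fs : Sig.{u}) (Ps : Sig.{v}) where
  pred : Ps.Sym
  args : Fin (Ps.arity pred) → Term Fs

/-- Atoms: user-defined ones, comparisons, and `s is t`. -/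
inductive Atom (Fs : Sig.{u}) (Ps : Sig.{v})
  | user : UserAtom Fs Ps → Atom Fs Ps
  | cmp : CmpRel → Term Fs → Term Fs → Atom Fs Ps
  | is : Term Fs → Term Fs → Atom Fs Ps

/-- Queries, and bodies of clauses. -/
abbrev Goal (Fs : Sig.{u}) (Ps : Sig.{v}) : Type (max u v) := List (Atom Fs Ps)

/-- A definite clause `head ← body`. -/
structure Clause (Fs : Sig.{u}) (Ps : Sig.{v}) where
  head : UserAtom Fs Ps
  body : Goal Fs Ps

section
variable {Fs : Sig.{u}} {Ps : Sig.{v}}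

def UserAtom.vars (a : UserAtom Fs Ps) : Finset ℕ :=
  Finset.univ.biUnion fun i => (a.args i).vars

def UserAtom.subst (θ : Subst Fs) (a : UserAtom Fs Ps) : UserAtom Fs Ps :=
  ⟨a.pred, fun i => (a.args i).subst θ⟩

def Atom.vars : Atom Fs Ps → Finset ℕ
  | .user a => a.vars
  | .cmp _ s t => s.vars ∪ t.vars
  | .is s t => s.vars ∪ t.vars

def Atom.subst (θ : Subst Fs) : Atom Fs Ps → Atom Fs Ps
  | .user a => .user (a.subst θ)
  | .cmp r s t => .cmp r (s.subst θ) (t.subst θ)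
  | .is s t => .is (s.subst θ) (t.subst θ)

def goalVars : Goal Fs Ps → Finset ℕ
  | [] => ∅
  | A :: R => A.vars ∪ goalVars R

def goalSubst (θ : Subst Fs) (G : Goal Fs Ps) : Goal Fs Ps := G.map (Atom.subst θ)

def Clause.vars (c : Clause Fs Ps) : Finset ℕ := c.head.vars ∪ goalVars c.body

def Clause.rename (π : Equiv.Perm ℕ) (c : Clause Fs Ps) : Clause Fs Ps :=
  ⟨c.head.subst (Subst.ofPerm π), goalSubst (Subst.ofPerm π) c.body⟩

/-! ## LD-resolution

SLD-resolution with the leftmost selection rule. A selected comparison succeeds if both sides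
are ground numerical expressions with a value and the comparison holds; a selected `s is t`
succeeds if `t` is a ground numerical expression with value `n` and `s` unifies with `n`.
In all other cases (including those where Prolog raises an error) a selected built-in has no
descendant. -/

/-- A state of an LD-derivation: the current query, the composition of the substitutions computed
so far, and the variables used so far (needed for standardising apart). -/
structure Config (Fs : Sig.{u}) (Ps : Sig.{v}) where
  goal : Goal Fs Ps
  answer : Subst Fs
  used : Finset ℕ

/-- One LD-resolution step. The label is the program clause used, or `none` for a built-in. -/
inductive Step (P : Set (Clause Fs Ps)) :
    Config Fs Ps → Option (Clause Fs Ps) → Config Fs Ps → Prop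
  | clause (a : UserAtom Fs Ps) (R : Goal Fs Ps) (σ : Subst Fs) (V : Finset ℕ)
      (c : Clause Fs Ps) (π : Equiv.Perm ℕ) (θ : Subst Fs)
      (hc : c ∈ P) (fresh : Disjoint (c.rename π).vars V)
      (mgu : IsMGU (fun τ => a.subst τ = (c.rename π).head.subst τ) θ) :
      Step P ⟨.user a :: R, σ, V⟩ (some c)
        ⟨goalSubst θ ((c.rename π).body ++ R), σ.comp θ, V ∪ (c.rename π).vars⟩
  | cmp (r : CmpRel) (s t : Term Fs) (R : Goal Fs Ps) (σ : Subst Fs) (V : Finset ℕ)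
      (h : r.HoldsOpt s.value t.value) :
      Step P ⟨.cmp r s t :: R, σ, V⟩ none ⟨R, σ, V⟩
  | is (s t : Term Fs) (n : ℤ) (R : Goal Fs Ps) (σ : Subst Fs) (V : Finset ℕ) (θ : Subst Fs)
      (h : t.value = some n)
      (mgu : IsMGU (fun τ => s.subst τ = .int n) θ) :
      Step P ⟨.is s t :: R, σ, V⟩ none ⟨goalSubst θ R, σ.comp θ, V⟩

/-- `Deriv P C w C'`: there is a finite LD-derivation from `C` to `C'` whose sequence of labels
is `w`. -/
inductive Deriv (P : Set (Clause Fs Ps)) :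
    Config Fs Ps → List (Option (Clause Fs Ps)) → Config Fs Ps → Prop
  | nil (C : Config Fs Ps) : Deriv P C [] C
  | cons {C C' C'' : Config Fs Ps} {l : Option (Clause Fs Ps)}
      {w : List (Option (Clause Fs Ps))} :
      Step P C l C' → Deriv P C' w C'' → Deriv P C (l :: w) C''

/-- The initial state for a query; clauses are standardised apart from the query and from the
variables in `V`. -/
def Config.init (G : Goal Fs Ps) (V : Finset ℕ) : Config Fs Ps :=
  ⟨G, fun x => .var x, V ∪ goalVars G⟩

/-- The nodes of the LD-tree for `(P, G)`. A node is given by the sequence of clauses (and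
built-in steps) on the path that leads to it from the root: by the variant lemma it determines the
query at the node up to renaming. -/
def ldTree (P : Set (Clause Fs Ps)) (G : Goal Fs Ps) : Set (List (Option (Clause Fs Ps))) :=
  {w | ∃ C, Deriv P (.init G ∅) w C}

/-- `G` LD-terminates for `P`: the LD-tree for `(P, G)` is finite. -/
def LDTerminates (P : Set (Clause Fs Ps)) (G : Goal Fs Ps) : Prop := (ldTree P G).Finite

/-- `Call(P, S)`: the atoms selected in LD-derivations for `P` and queries in `S`. -/
def Call (P : Set (Clause Fs Ps)) (S : Set (UserAtom Fs Ps)) : Set (Atom Fs Ps) :=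
  {A | ∃ Q ∈ S, ∃ w R σ V, Deriv P (.init [.user Q] ∅) w ⟨A :: R, σ, V⟩}

/-- `σ` is a computed answer substitution for `G`, computed by an LD-derivation in which the
clauses are standardised apart also from the variables in `V`. -/
def IsComputedAnswer (P : Set (Clause Fs Ps)) (V : Finset ℕ) (G : Goal Fs Ps) (σ : Subst Fs) :
    Prop :=
  ∃ w τ W, Deriv P (.init G V) w ⟨[], τ, W⟩ ∧
    ∀ x, σ x = if x ∈ goalVars G then τ x else .var x

/-! ## Mutual recursion and acceptability -/

/-- `p` refers to `q`. -/
def RefersTo (P : Set (Clause Fs Ps)) (p q : Ps.Sym) : Prop :=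
  ∃ c ∈ P, c.head.pred = p ∧ ∃ b : UserAtom Fs Ps, .user b ∈ c.body ∧ b.pred = q

/-- `p ⊒ q`: `p` depends on `q`. -/
def DependsOn (P : Set (Clause Fs Ps)) : Ps.Sym → Ps.Sym → Prop :=
  Relation.ReflTransGen (RefersTo P)

/-- `p ≃ q`: `p` and `q` are mutually recursive. -/
def MutRec (P : Set (Clause Fs Ps)) (p q : Ps.Sym) : Prop :=
  DependsOn P p q ∧ DependsOn P q p

/-- The variant relation on atoms. -/
def Variant (A B : Atom Fs Ps) : Prop :=
  ∃ π : Equiv.Perm ℕ, A.subst (Subst.ofPerm π) = B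

/-- The extended Herbrand base: atoms modulo the variant relation. -/
def ExtHerbrandBase (Fs : Sig.{u}) (Ps : Sig.{v}) : Type (max u v) :=
  Quot (Variant (Fs := Fs) (Ps := Ps))

/-- `P` is acceptable with respect to the set `S` of atomic queries. (Calls to built-ins unify
with no clause head, and no built-in is mutually recursive with a user-defined predicate, so only
user-defined atoms matter.) -/
def Acceptable (P : Set (Clause Fs Ps)) (S : Set (UserAtom Fs Ps)) : Prop :=
  ∃ level : ExtHerbrandBase Fs Ps → ℕ,
    ∀ a : UserAtom Fs Ps, .user a ∈ Call P S →
    ∀ c ∈ P, ∀ π : Equiv.Perm ℕ, Disjoint (c.rename π).vars a.vars →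
    ∀ θ : Subst Fs, IsMGU (fun τ => a.subst τ = (c.rename π).head.subst τ) θ →
    ∀ (pre : Goal Fs Ps) (b : UserAtom Fs Ps) (post : Goal Fs Ps),
      (c.rename π).body = pre ++ .user b :: post → MutRec P b.pred a.pred →
    ∀ σ : Subst Fs,
      IsComputedAnswer P (a.vars ∪ (c.rename π).vars) (goalSubst θ pre) σ →
      level (Quot.mk _ (.user a)) > level (Quot.mk _ (.user ((b.subst θ).subst σ)))

end

/-! ## Symbolic conditions and sets of adornments -/

/-- Numerical expressions over the argument position denominators `$1, …, $n`. -/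
inductive SymExpr (n : ℕ)
  | int : ℤ → SymExpr n
  | pos : Fin n → SymExpr n
  | arith : ArithOp → SymExpr n → SymExpr n → SymExpr n

/-- Propositional formulae over symbolic inequalities. -/
inductive SymCond (n : ℕ)
  | true : SymCond n
  | false : SymCond n
  | ineq : CmpRel → SymExpr n → SymExpr n → SymCond n
  | not : SymCond n → SymCond n
  | and : SymCond n → SymCond n → SymCond n
  | or : SymCond n → SymCond n → SymCond n

def SymExpr.eval {n : ℕ} (z : Fin n → ℤ) : SymExpr n → Option ℤ
  | .int m => some m
  | .pos i => some (z i)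
  | .arith o e f => (e.eval z).bind fun a => (f.eval z).bind fun b => o.eval a b

/-- The argument positions occurring in an expression. -/
def SymExpr.positions {n : ℕ} : SymExpr n → Finset (Fin n)
  | .int _ => ∅
  | .pos i => {i}
  | .arith _ e f => e.positions ∪ f.positions

/-- The condition holds if the argument positions have the values `z`. -/
def SymCond.Holds {n : ℕ} (z : Fin n → ℤ) : SymCond n → Prop
  | .true => True
  | .false => False
  | .ineq r e f => r.HoldsOpt (e.eval z) (f.eval z)
  | .not c => ¬ c.Holds z
  | .and c d => c.Holds z ∧ d.Holds z
  | .or c d => c.Holds z ∨ d.Holds z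

/-- The argument positions occurring in a condition. -/
def SymCond.positions {n : ℕ} : SymCond n → Finset (Fin n)
  | .true => ∅
  | .false => ∅
  | .ineq _ e f => e.positions ∪ f.positions
  | .not c => c.positions
  | .and c d => c.positions ∪ d.positions
  | .or c d => c.positions ∪ d.positions

section
variable {Fs : Sig.{u}} {Ps : Sig.{v}}

/-- The `i`-th argument position of `p` is an integer argument position: it is occupied by an
integer in every call to `p` that arises from `S`. -/
def IsIntegerPosition (P : Set (Clause Fs Ps)) (S : Set (UserAtom Fs Ps)) (p : Ps.Sym)
    (i : Fin (Ps.arity p)) : Prop :=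
  ∀ ts : Fin (Ps.arity p) → Term Fs, .user ⟨p, ts⟩ ∈ Call P S → ∃ n : ℤ, ts i = .int n

/-- `A` is a set of adornments for `p`: a finite set of symbolic conditions over the integer
arguments of `p` that are pairwise contradictory and whose disjunction is valid. -/
structure IsAdornmentSet (P : Set (Clause Fs Ps)) (S : Set (UserAtom Fs Ps)) (p : Ps.Sym)
    (A : Finset (SymCond (Ps.arity p))) : Prop where
  integer_positions : ∀ c ∈ A, ∀ i ∈ c.positions, IsIntegerPosition P S p i
  disjoint : ∀ c ∈ A, ∀ d ∈ A, c ≠ d → ∀ z, ¬ (c.Holds z ∧ d.Holds z)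
  cover : ∀ z, ∃ c ∈ A, c.Holds z

/-! ## The adorned program -/

/-- The predicates of the adorned program: the original predicates `p` and their adorned versions
`p^A`. -/
inductive AdornedSym (Ps : Sig.{v}) : Type v
  | plain : Ps.Sym → AdornedSym Ps
  | adorned : (p : Ps.Sym) → SymCond (Ps.arity p) → AdornedSym Ps

/-- The predicate of which an adorned predicate is a version. -/
def AdornedSym.base : AdornedSym Ps → Ps.Sym
  | .plain p => p
  | .adorned p _ => p

/-- The signature of adorned predicates. -/
def Sig.adorn (Ps : Sig.{v}) : Sig.{v} := ⟨AdornedSym Ps, fun q => Ps.arity q.base⟩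

/-- Deleting the adornment of an atom. -/
def UserAtom.erase (a : UserAtom Fs Ps.adorn) : UserAtom Fs Ps :=
  ⟨AdornedSym.base a.pred, a.args⟩

/-- Deleting the adornment of an atom, if it has one. -/
def Atom.erase : Atom Fs Ps.adorn → Atom Fs Ps
  | .user a => .user a.erase
  | .cmp r s t => .cmp r s t
  | .is s t => .is s t

/-- Deleting all adornments in a clause. -/
def Clause.erase (c : Clause Fs Ps.adorn) : Clause Fs Ps :=
  ⟨c.head.erase, c.body.map Atom.erase⟩

/-- The atom is an integer inequality all of whose variables are variables of `H`. -/
def Atom.isPrefixAtom (H : UserAtom Fs Ps) : Atom Fs Ps → Bool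
  | .cmp _ s t => s.isExpr && t.isExpr && decide (s.vars ∪ t.vars ⊆ H.vars)
  | _ => false

/-- The maximal prefix of a rule. -/
def Clause.maxPrefix (c : Clause Fs Ps) : Goal Fs Ps :=
  c.body.takeWhile (Atom.isPrefixAtom c.head)

/-- The predicates that are adorned: those that are mutually recursive with the predicate of some
query in `S`. -/
def AdornedPreds (P : Set (Clause Fs Ps)) (S : Set (UserAtom Fs Ps)) : Set Ps.Sym :=
  {q | ∃ Q ∈ S, MutRec P q Q.pred}

/-- The predicate symbol is one that may occur in the adorned program: `q^A` with `A ∈ 𝒜 q` if `q`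
is to be adorned, and `q` itself otherwise. -/
def AdornedSym.Proper (D : Set Ps.Sym) (𝒜 : (p : Ps.Sym) → Finset (SymCond (Ps.arity p))) :
    AdornedSym Ps → Prop
  | .plain q => q ∉ D
  | .adorned q A => q ∈ D ∧ A ∈ 𝒜 q

/-- Under the assignment `ν` of integers to variables, the comparison holds. -/
def Atom.CmpTrue (ν : ℕ → ℤ) : Atom Fs Ps → Prop
  | .cmp r s t => r.HoldsOpt (s.eval fun x => some (ν x)) (t.eval fun x => some (ν x))
  | _ => True

/-- A condition on argument tuples `ts` is satisfied under the assignment `ν`. The denominator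
`$i` stands for the value of `ts i` under `ν`; a term that has no integer value under `ν` (such as
a term with a non-arithmetical function symbol) imposes no restriction. -/
def SymCond.InstanceTrue {n : ℕ} (ν : ℕ → ℤ) (c : SymCond n) (ts : Fin n → Term Fs) : Prop :=
  ∃ z : Fin n → ℤ, (∀ i m, ((ts i).eval fun x => some (ν x)) = some m → z i = m) ∧ c.Holds z

/-- The adornment of the atom, if it has one, is satisfied under the assignment `ν`. -/
def UserAtom.AdornmentTrue (ν : ℕ → ℤ) : UserAtom Fs Ps.adorn → Prop
  | ⟨.plain _, _⟩ => True
  | ⟨.adorned _ c, ts⟩ => c.InstanceTrue ν ts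

/-- The consistency check: the adornment of the head (if any), the comparisons of the maximal
prefix and the adornments of the body atoms are jointly satisfiable over the integers. No other
inequality of the body is taken into account. -/
def Clause.Consistent (c : Clause Fs Ps.adorn) : Prop :=
  ∃ ν : ℕ → ℤ, (∀ B ∈ c.maxPrefix, B.CmpTrue ν) ∧ c.head.AdornmentTrue ν ∧
    ∀ b : UserAtom Fs Ps.adorn, .user b ∈ c.body → b.AdornmentTrue ν

/-- The adorned program `P^a`: all clauses that are obtained from a clause of `P` by replacing,
in body and head, every predicate `q` to be adorned by some `q^A` with `A ∈ 𝒜 q` (independently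
for each occurrence), and that pass the consistency check. -/
def adornedProgram (P : Set (Clause Fs Ps)) (D : Set Ps.Sym)
    (𝒜 : (p : Ps.Sym) → Finset (SymCond (Ps.arity p))) : Set (Clause Fs Ps.adorn) :=
  {c | c.erase ∈ P ∧ AdornedSym.Proper D 𝒜 c.head.pred ∧
    (∀ b : UserAtom Fs Ps.adorn, .user b ∈ c.body → AdornedSym.Proper D 𝒜 b.pred) ∧
    c.Consistent}

/-- The set of queries `{q^A(t₁,…,tₙ) | q(t₁,…,tₙ) ∈ S, A ∈ 𝒜 q}`. -/
def adornedQueries (S : Set (UserAtom Fs Ps))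
    (𝒜 : (p : Ps.Sym) → Finset (SymCond (Ps.arity p))) : Set (UserAtom Fs Ps.adorn) :=
  {a | ∃ Q ∈ S, ∃ A ∈ 𝒜 Q.pred, a = ⟨.adorned Q.pred A, Q.args⟩}

end

end LP

/-!
The proof compares LD-derivations of a program `P` with those of its adorned program `P^a`.

Erasing adornments maps derivations of `P^a` to derivations of `P` of the same length (`Run.erase`).
Hence, if `P` terminates for the queries in `S`, the LD-trees of `P^a` for the adorned queries have
bounded depth, and then `P^a` is acceptable with the depth of the LD-tree as level mapping
(`acceptable_of_bounded`): an instance `Bᵢθσ` of a body atom is called at least one step after the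
call `A`, so its tree is less deep. This rests on the variant lemma (`Run.exists_variant`), by which
the label sequences of derivations do not depend on the names of the variables.

For the converse, a derivation of `P` cannot be lifted to `P^a` step by step, because the adorned
clause has to be consistent and its body atoms have to carry the adornments with which they are
called later. A refutation, however, can be lifted as a whole (`Run.lift`): the values of the
variables under its computed answer form one assignment of integers, from which the adornments of
all body atoms are read off and which satisfies the comparisons of the maximal prefix, since in a
refutation these have been selected and have succeeded. Adornments refer only to integer argument
positions, so the adornment read off at the creation of an atom is still right when the atom is
called (`UserAtom.Fits`). If a call to `B` arises from a call to `A` through a clause, the part of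
the body to the left of `B` has been refuted and contains the maximal prefix. Therefore the descent
from `A` to `B` also takes place in `P^a` (`exists_adorned_call`), where either the dependency order
of the finitely many predicates or the level decreases. Well-founded induction excludes infinite
derivations of `P` (`SN.of_acceptable`), and as `P` is finite and resolvents are unique up to
renaming, its LD-trees are finite (`SN.finite_words`).
-/

namespace LP

/-! ### Finite permutations of the variables -/

/-- A map that is injective on a finite set of variables agrees there with a permutation. -/
theorem exists_perm_eqOn (f : ℕ → ℕ) (s : Finset ℕ) (hf : Set.InjOn f s) :
    ∃ π : Equiv.Perm ℕ, ∀ x ∈ s, π x = f x := by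
  obtain ⟨π, hπ⟩ := Equiv.Perm.exists_extending_pair (fun x : s => (x : ℕ)) (fun x => f x)
    Subtype.val_injective (fun x y h => Subtype.ext (hf x.2 y.2 h))
  exact ⟨π, fun x hx => hπ ⟨x, hx⟩⟩

/-- Every finite set of variables can be renamed away from another one. -/
theorem exists_perm_fresh (s V : Finset ℕ) :
    ∃ π : Equiv.Perm ℕ, ∀ x ∈ s, π x ∉ V := by
  obtain ⟨π, hπ⟩ := exists_perm_eqOn (fun x => x + (V.sup id + 1)) s
    (fun x _ y _ h => Nat.add_right_cancel h)
  refine ⟨π, fun x hx hV => ?_⟩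
  have := Finset.le_sup (f := id) hV
  rw [hπ x hx] at this
  simp only [id] at this
  omega

/-- Two permutations of the variables, given on disjoint finite sets with disjoint images, can be
merged into one. -/
theorem exists_perm_merge (s t : Finset ℕ) (f g : Equiv.Perm ℕ) (hst : Disjoint s t)
    (himg : ∀ x ∈ s, ∀ y ∈ t, f x ≠ g y) :
    ∃ π : Equiv.Perm ℕ, (∀ x ∈ s, π x = f x) ∧ ∀ x ∈ t, π x = g x := by
  classical
  have hts : ∀ x ∈ t, x ∉ s := fun x hx hs => Finset.disjoint_left.1 hst hs hx
  obtain ⟨π, hπ⟩ := exists_perm_eqOn (fun x => if x ∈ s then f x else g x) (s ∪ t) (by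
    intro x hx y hy h
    simp only [Finset.coe_union, Set.mem_union, Finset.mem_coe] at hx hy
    by_cases h1 : x ∈ s <;> by_cases h2 : y ∈ s <;> simp only [h1, h2, if_true, if_false] at h
    · exact f.injective h
    · exact absurd h (himg x h1 y (hy.resolve_left h2))
    · exact absurd h.symm (himg y h2 x (hx.resolve_left h1))
    · exact g.injective h)
  refine ⟨π, fun x hx => ?_, fun x hx => ?_⟩
  · rw [hπ x (Finset.mem_union_left _ hx), if_pos hx]
  · rw [hπ x (Finset.mem_union_right _ hx), if_neg (hts x hx)]

/-! ### Substitution calculus -/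

/-- The identity substitution. -/
def Subst.id {Fs : Sig.{u}} : Subst Fs := fun x => .var x

section
variable {Fs : Sig.{u}} {Ps : Sig.{v}}

theorem Term.subst_comp (σ τ : Subst Fs) (t : Term Fs) :
    t.subst (σ.comp τ) = (t.subst σ).subst τ := by
  induction t with
  | var x => rfl
  | int n => rfl
  | arith o s t hs ht => simp [Term.subst, hs, ht]
  | fn f ts ih => simp [Term.subst, ih]

theorem Term.subst_id (t : Term Fs) : t.subst Subst.id = t := by
  induction t with
  | var x => rfl
  | int n => rfl
  | arith o s t hs ht => simp [Term.subst, hs, ht]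
  | fn f ts ih => simp [Term.subst, ih]

theorem Term.subst_eq_iff (σ τ : Subst Fs) (t : Term Fs) :
    t.subst σ = t.subst τ ↔ ∀ x ∈ t.vars, σ x = τ x := by
  induction t with
  | var x => simp [Term.subst, Term.vars]
  | int n => simp [Term.subst, Term.vars]
  | arith o s t hs ht => simp [Term.subst, Term.vars, hs, ht, or_imp, forall_and]
  | fn f ts ih =>
    simp only [Term.subst, Term.vars, Term.fn.injEq, heq_eq_eq, true_and, funext_iff, ih,
      Finset.mem_biUnion, Finset.mem_univ]
    exact ⟨fun h x ⟨i, hi⟩ => h i x hi, fun h i x hi => h x ⟨i, hi⟩⟩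

theorem Term.mem_vars_subst (σ : Subst Fs) (t : Term Fs) (y : ℕ) :
    y ∈ (t.subst σ).vars ↔ ∃ x ∈ t.vars, y ∈ (σ x).vars := by
  induction t with
  | var x => simp [Term.subst, Term.vars]
  | int n => simp [Term.subst, Term.vars]
  | arith o s t hs ht => simp [Term.subst, Term.vars, hs, ht, or_and_right, exists_or]
  | fn f ts ih =>
    simp only [Term.subst, Term.vars, Finset.mem_biUnion, Finset.mem_univ, true_and, ih]
    exact ⟨fun ⟨i, x, h1, h2⟩ => ⟨x, ⟨i, h1⟩, h2⟩, fun ⟨x, ⟨i, h1⟩, h2⟩ => ⟨i, x, h1, h2⟩⟩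

theorem Subst.comp_assoc (ρ σ τ : Subst Fs) : (ρ.comp σ).comp τ = ρ.comp (σ.comp τ) := by
  funext x; exact (Term.subst_comp σ τ (ρ x)).symm

theorem Subst.id_comp (σ : Subst Fs) : Subst.id.comp σ = σ := rfl

theorem Subst.comp_id (σ : Subst Fs) : σ.comp Subst.id = σ := by
  funext x; exact Term.subst_id _

theorem Subst.ofPerm_comp (π ρ : Equiv.Perm ℕ) :
    (Subst.ofPerm π : Subst Fs).comp (Subst.ofPerm ρ) = Subst.ofPerm (π.trans ρ) := rfl

theorem Subst.ofPerm_comp_symm (π : Equiv.Perm ℕ) :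
    (Subst.ofPerm π : Subst Fs).comp (Subst.ofPerm π.symm) = Subst.id := by
  funext x; simp [Subst.comp, Subst.ofPerm, Term.subst, Subst.id]

theorem Subst.ofPerm_symm_comp (π : Equiv.Perm ℕ) :
    (Subst.ofPerm π.symm : Subst Fs).comp (Subst.ofPerm π) = Subst.id := by
  funext x; simp [Subst.comp, Subst.ofPerm, Term.subst, Subst.id]

theorem UserAtom.subst_comp (σ τ : Subst Fs) (a : UserAtom Fs Ps) :
    a.subst (σ.comp τ) = (a.subst σ).subst τ := by
  simp [UserAtom.subst, Term.subst_comp]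

theorem UserAtom.subst_id (a : UserAtom Fs Ps) : a.subst Subst.id = a := by
  simp [UserAtom.subst, Term.subst_id]

theorem UserAtom.subst_eq_iff (σ τ : Subst Fs) (a : UserAtom Fs Ps) :
    a.subst σ = a.subst τ ↔ ∀ x ∈ a.vars, σ x = τ x := by
  simp only [UserAtom.subst, UserAtom.vars, UserAtom.mk.injEq, heq_eq_eq, true_and, funext_iff,
    Term.subst_eq_iff, Finset.mem_biUnion, Finset.mem_univ]
  exact ⟨fun h x ⟨i, hi⟩ => h i x hi, fun h i x hi => h x ⟨i, hi⟩⟩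

theorem UserAtom.mem_vars_subst (σ : Subst Fs) (a : UserAtom Fs Ps) (y : ℕ) :
    y ∈ (a.subst σ).vars ↔ ∃ x ∈ a.vars, y ∈ (σ x).vars := by
  constructor
  · intro h
    obtain ⟨i, -, hi⟩ := Finset.mem_biUnion.1 h
    obtain ⟨x, h1, h2⟩ := (Term.mem_vars_subst σ _ y).1 hi
    exact ⟨x, Finset.mem_biUnion.2 ⟨i, Finset.mem_univ _, h1⟩, h2⟩
  · rintro ⟨x, h1, h2⟩
    obtain ⟨i, -, hi⟩ := Finset.mem_biUnion.1 h1
    exact Finset.mem_biUnion.2 ⟨i, Finset.mem_univ _, (Term.mem_vars_subst σ _ y).2 ⟨x, hi, h2⟩⟩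

theorem Atom.subst_comp (σ τ : Subst Fs) (A : Atom Fs Ps) :
    A.subst (σ.comp τ) = (A.subst σ).subst τ := by
  cases A <;> simp [Atom.subst, Term.subst_comp, UserAtom.subst_comp]

theorem Atom.subst_id (A : Atom Fs Ps) : A.subst Subst.id = A := by
  cases A <;> simp [Atom.subst, Term.subst_id, UserAtom.subst_id]

theorem Atom.subst_eq_iff (σ τ : Subst Fs) (A : Atom Fs Ps) :
    A.subst σ = A.subst τ ↔ ∀ x ∈ A.vars, σ x = τ x := by
  cases A <;> simp [Atom.subst, Atom.vars, Term.subst_eq_iff, UserAtom.subst_eq_iff, or_imp,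
    forall_and]

theorem Atom.mem_vars_subst (σ : Subst Fs) (A : Atom Fs Ps) (y : ℕ) :
    y ∈ (A.subst σ).vars ↔ ∃ x ∈ A.vars, y ∈ (σ x).vars := by
  cases A <;> simp [Atom.subst, Atom.vars, Term.mem_vars_subst, UserAtom.mem_vars_subst,
    or_and_right, exists_or]

theorem goalSubst_cons (σ : Subst Fs) (A : Atom Fs Ps) (G : Goal Fs Ps) :
    goalSubst σ (A :: G) = A.subst σ :: goalSubst σ G := rfl

theorem goalSubst_append (σ : Subst Fs) (G H : Goal Fs Ps) :
    goalSubst σ (G ++ H) = goalSubst σ G ++ goalSubst σ H := by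
  simp [goalSubst]

theorem goalSubst_comp (σ τ : Subst Fs) (G : Goal Fs Ps) :
    goalSubst (σ.comp τ) G = goalSubst τ (goalSubst σ G) := by
  simp [goalSubst, Atom.subst_comp]

theorem goalSubst_id (G : Goal Fs Ps) : goalSubst Subst.id G = G := by
  induction G with
  | nil => rfl
  | cons A G ih => rw [goalSubst_cons, Atom.subst_id, ih]

theorem goalVars_append (G H : Goal Fs Ps) : goalVars (G ++ H) = goalVars G ∪ goalVars H := by
  induction G with
  | nil => simp [goalVars]
  | cons A G ih => simp [goalVars, ih, Finset.union_assoc]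

theorem goalSubst_eq_iff (σ τ : Subst Fs) (G : Goal Fs Ps) :
    goalSubst σ G = goalSubst τ G ↔ ∀ x ∈ goalVars G, σ x = τ x := by
  induction G with
  | nil => simp [goalSubst, goalVars]
  | cons A G ih => simp [goalSubst_cons, goalVars, ih, Atom.subst_eq_iff, or_imp, forall_and]

theorem mem_goalVars_goalSubst (σ : Subst Fs) (G : Goal Fs Ps) (y : ℕ) :
    y ∈ goalVars (goalSubst σ G) ↔ ∃ x ∈ goalVars G, y ∈ (σ x).vars := by
  induction G with
  | nil => simp [goalSubst, goalVars]
  | cons A G ih => simp [goalSubst_cons, goalVars, ih, Atom.mem_vars_subst, or_and_right,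
      exists_or]

theorem mem_goalVars_ofPerm (π : Equiv.Perm ℕ) (G : Goal Fs Ps) (y : ℕ) :
    y ∈ goalVars (goalSubst (Subst.ofPerm π) G) ↔ ∃ x ∈ goalVars G, y = π x := by
  simp [mem_goalVars_goalSubst, Subst.ofPerm, Term.vars]

theorem Clause.mem_vars_rename (π : Equiv.Perm ℕ) (c : Clause Fs Ps) (y : ℕ) :
    y ∈ (c.rename π).vars ↔ ∃ x ∈ c.vars, y = π x := by
  simp [Clause.vars, Clause.rename, mem_goalVars_ofPerm, UserAtom.mem_vars_subst, Subst.ofPerm,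
    Term.vars, or_and_right, exists_or]

/-! ### Values of ground expressions -/

theorem Term.subst_of_value {t : Term Fs} {m : ℤ} (h : t.value = some m) (τ : Subst Fs) :
    t.subst τ = t := by
  induction t generalizing m with
  | var x => simp [Term.value, Term.eval] at h
  | int n => rfl
  | arith o s t hs ht =>
    simp only [Term.value, Term.eval, Option.bind_eq_some_iff] at h
    obtain ⟨a, h1, b, h2, -⟩ := h
    simp [Term.subst, hs h1, ht h2]
  | fn f ts ih => simp [Term.value, Term.eval] at h

theorem CmpRel.HoldsOpt.subst_eq {r : CmpRel} {s t : Term Fs} (h : r.HoldsOpt s.value t.value)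
    (τ : Subst Fs) : s.subst τ = s ∧ t.subst τ = t := by
  obtain ⟨m, n, h1, h2, -⟩ := h
  exact ⟨Term.subst_of_value h1 τ, Term.subst_of_value h2 τ⟩

/-- If the instance `t σ` is a ground expression with a value, then `t` has the same value under
every assignment that extends the values of the variables under `σ`. -/
theorem Term.eval_of_value_subst {t : Term Fs} {σ : Subst Fs} {m : ℤ} {ν : ℕ → ℤ}
    (hν : ∀ x n, (σ x).value = some n → ν x = n) (h : (t.subst σ).value = some m) :
    t.eval (fun x => some (ν x)) = some m := by
  induction t generalizing m with
  | var x => simp [Term.eval, hν x m h]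
  | int n => simpa [Term.value, Term.subst, Term.eval] using h
  | arith o s t hs ht =>
    simp only [Term.value, Term.subst, Term.eval, Option.bind_eq_some_iff] at h ⊢
    obtain ⟨a, h1, b, h2, h3⟩ := h
    exact ⟨a, hs h1, b, ht h2, h3⟩
  | fn f ts ih => simp [Term.value, Term.subst, Term.eval] at h

end

/-! ### Most general unifiers -/

section
variable {Fs : Sig.{u}}

/-- Relevance of idempotent most general solutions: variables outside the unification problem are
left fixed. -/
theorem IsMGU.eq_var {U : Subst Fs → Prop} {θ : Subst Fs} (h : IsMGU U θ) {X : Finset ℕ}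
    (hU : ∀ τ τ' : Subst Fs, (∀ x ∈ X, τ x = τ' x) → U τ → U τ') {x : ℕ} (hx : x ∉ X) :
    θ x = .var x := by
  classical
  obtain ⟨δ, hδ⟩ := h.most_general (Function.update θ x (.var x)) (hU θ _ (fun y hy => by
    rw [Function.update_of_ne]; rintro rfl; exact hx hy) h.unifies)
  have h1 : (θ x).subst δ = .var x := by
    have := congrFun hδ x
    simpa [Subst.comp] using this.symm
  cases hz : θ x with
  | var z =>
    rw [hz] at h1
    by_cases hzx : z = x
    · rw [hzx]
    · -- `θ` fixes `z` by idempotence, so `δ` would have to map `z` both to `z` and to `x`.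
      have h2 : θ z = .var z := by
        have := congrFun h.idempotent x
        simp only [Subst.comp, hz] at this
        exact this
      have h3 := congrFun hδ z
      rw [Function.update_of_ne hzx, h2] at h3
      simp only [Subst.comp, h2] at h3
      rw [h3]; exact h1
  | int n => rw [hz] at h1; simp [Term.subst] at h1
  | arith o s t => rw [hz] at h1; simp [Term.subst] at h1
  | fn f ts => rw [hz] at h1; simp [Term.subst] at h1

/-- Relevance of idempotent most general solutions: no variables from outside the unification
problem are introduced. -/
theorem IsMGU.vars_subset {U : Subst Fs → Prop} {θ : Subst Fs} (h : IsMGU U θ) {X : Finset ℕ}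
    (hU : ∀ τ τ' : Subst Fs, (∀ x ∈ X, τ x = τ' x) → U τ → U τ')
    (hUc : ∀ τ δ : Subst Fs, U τ → U (τ.comp δ)) {y : ℕ} (hy : y ∈ X) :
    (θ y).vars ⊆ X := by
  classical
  intro x hx
  by_contra hxX
  have hne : ∀ z ∈ X, z ≠ x := fun z hz e => hxX (e ▸ hz)
  -- A solution that maps `x` to itself, but has `0` in place of `x` in the other images, is not an
  -- instance of `θ`.
  let ρ : Subst Fs := Function.update Subst.id x (.int 0)
  obtain ⟨δ, hδ⟩ := h.most_general (Function.update (θ.comp ρ) x (.var x))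
    (hU (θ.comp ρ) _ (fun z hz => (Function.update_of_ne (hne z hz) _ _).symm)
      (hUc θ ρ h.unifies))
  have h1 : δ x = .var x := by
    have := congrFun hδ x
    rw [Function.update_self] at this
    simp only [Subst.comp, h.eq_var hU hxX] at this
    exact this.symm
  have h2 := congrFun hδ y
  rw [Function.update_of_ne (hne y hy)] at h2
  have h3 := (Term.subst_eq_iff ρ δ (θ y)).1 h2 x hx
  simp [ρ, h1] at h3

/-- Two idempotent most general solutions of the same problem yield the same instances up to a
renaming of variables. -/
theorem IsMGU.exists_perm {Ps : Sig.{v}} {U : Subst Fs → Prop} {θ θ' : Subst Fs} (h : IsMGU U θ)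
    (h' : IsMGU U θ') (G : Goal Fs Ps) :
    ∃ π : Equiv.Perm ℕ, goalSubst θ' G = goalSubst (Subst.ofPerm π) (goalSubst θ G) := by
  classical
  obtain ⟨δ, hδ⟩ := h.most_general θ' h'.unifies
  obtain ⟨ε, hε⟩ := h'.most_general θ h.unifies
  -- On the variables of `G θ` the substitution `δ` is inverted by `ε`, so it maps them injectively
  -- to variables.
  have hinv : ∀ x ∈ goalVars (goalSubst θ G), (δ x).subst ε = .var x := by
    have : goalSubst (δ.comp ε) (goalSubst θ G) = goalSubst Subst.id (goalSubst θ G) := by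
      rw [goalSubst_id, ← goalSubst_comp, ← Subst.comp_assoc, ← hδ, ← hε]
    exact (goalSubst_eq_iff _ _ _).1 this
  have hvar : ∀ x ∈ goalVars (goalSubst θ G), ∃ y, δ x = .var y := by
    intro x hx
    have := hinv x hx
    cases hz : δ x with
    | var z => exact ⟨z, rfl⟩
    | int n => rw [hz] at this; simp [Term.subst] at this
    | arith o s t => rw [hz] at this; simp [Term.subst] at this
    | fn f ts => rw [hz] at this; simp [Term.subst] at this
  choose! f hf using hvar
  obtain ⟨π, hπ⟩ := exists_perm_eqOn f (goalVars (goalSubst θ G)) (by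
    intro x hx y hy hxy
    have h1 := hinv x hx
    have h2 := hinv y hy
    rw [hf x hx, hxy, ← hf y hy, h2] at h1
    exact (Term.var.inj h1).symm)
  refine ⟨π, ?_⟩
  rw [hδ, goalSubst_comp, goalSubst_eq_iff]
  intro x hx
  rw [hf x hx, Subst.ofPerm, hπ x hx]

/-- Conjugating a most general solution with a permutation of the variables. -/
theorem IsMGU.conj {U U' : Subst Fs → Prop} {θ : Subst Fs} (h : IsMGU U θ) (π : Equiv.Perm ℕ)
    (hU : ∀ τ, U ((Subst.ofPerm π).comp τ) ↔ U' τ) (hUc : ∀ τ δ : Subst Fs, U τ → U (τ.comp δ)) :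
    IsMGU U' (((Subst.ofPerm π.symm).comp θ).comp (Subst.ofPerm π)) where
  unifies := by
    rw [← hU, Subst.comp_assoc, ← Subst.comp_assoc, Subst.ofPerm_comp_symm, Subst.id_comp]
    exact hUc _ _ h.unifies
  most_general τ hτ := by
    obtain ⟨δ, hδ⟩ := h.most_general _ ((hU τ).2 hτ)
    refine ⟨(Subst.ofPerm π.symm).comp δ, ?_⟩
    rw [Subst.comp_assoc, Subst.comp_assoc, ← Subst.comp_assoc (Subst.ofPerm π),
      Subst.ofPerm_comp_symm, Subst.id_comp, ← hδ, ← Subst.comp_assoc, Subst.ofPerm_symm_comp,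
      Subst.id_comp]
  idempotent := by
    simp only [Subst.comp_assoc]
    rw [← Subst.comp_assoc (Subst.ofPerm π), Subst.ofPerm_comp_symm, Subst.id_comp,
      ← Subst.comp_assoc θ, h.idempotent]

end

/-! ### Derivations without answers -/

section
variable {Fs : Sig.{u}} {Ps : Sig.{v}}

/-- An LD-resolution step on a query and the set of variables used so far, together with the
substitution that this step computes. -/
inductive GStep (P : Set (Clause Fs Ps)) : Goal Fs Ps → Finset ℕ → Option (Clause Fs Ps) →
    Subst Fs → Goal Fs Ps → Finset ℕ → Prop
  | clause (a : UserAtom Fs Ps) (R : Goal Fs Ps) (V : Finset ℕ)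
      (c : Clause Fs Ps) (π : Equiv.Perm ℕ) (θ : Subst Fs)
      (hc : c ∈ P) (fresh : Disjoint (c.rename π).vars V)
      (mgu : IsMGU (fun τ => a.subst τ = (c.rename π).head.subst τ) θ) :
      GStep P (.user a :: R) V (some c) θ (goalSubst θ ((c.rename π).body ++ R))
        (V ∪ (c.rename π).vars)
  | cmp (r : CmpRel) (s t : Term Fs) (R : Goal Fs Ps) (V : Finset ℕ)
      (h : r.HoldsOpt s.value t.value) :
      GStep P (.cmp r s t :: R) V none Subst.id R V
  | is (s t : Term Fs) (n : ℤ) (R : Goal Fs Ps) (V : Finset ℕ) (θ : Subst Fs)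
      (h : t.value = some n)
      (mgu : IsMGU (fun τ => s.subst τ = .int n) θ) :
      GStep P (.is s t :: R) V none θ (goalSubst θ R) V

/-- A finite LD-derivation, with its sequence of labels and the composition of the substitutions
computed on the way. -/
inductive Run (P : Set (Clause Fs Ps)) : Goal Fs Ps → Finset ℕ → List (Option (Clause Fs Ps)) →
    Subst Fs → Goal Fs Ps → Finset ℕ → Prop
  | nil (G : Goal Fs Ps) (V : Finset ℕ) : Run P G V [] Subst.id G V
  | cons {G G₁ G₂ : Goal Fs Ps} {V V₁ V₂ : Finset ℕ} {l : Option (Clause Fs Ps)}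
      {w : List (Option (Clause Fs Ps))} {θ τ : Subst Fs} :
      GStep P G V l θ G₁ V₁ → Run P G₁ V₁ w τ G₂ V₂ → Run P G V (l :: w) (θ.comp τ) G₂ V₂

variable {P : Set (Clause Fs Ps)}

theorem GStep.toStep {G G' : Goal Fs Ps} {V V' : Finset ℕ} {l : Option (Clause Fs Ps)}
    {θ : Subst Fs} (h : GStep P G V l θ G' V') (σ : Subst Fs) :
    Step P ⟨G, σ, V⟩ l ⟨G', σ.comp θ, V'⟩ := by
  cases h with
  | clause a R _ c π _ hc fresh mgu => exact .clause a R σ V c π θ hc fresh mgu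
  | cmp r s t _ _ h => rw [Subst.comp_id]; exact .cmp r s t G' σ V h
  | is s t n R _ _ h mgu => exact .is s t n R σ V θ h mgu

theorem Step.exists_gStep {C C' : Config Fs Ps} {l : Option (Clause Fs Ps)} (h : Step P C l C') :
    ∃ θ, GStep P C.goal C.used l θ C'.goal C'.used ∧ C'.answer = C.answer.comp θ := by
  cases h with
  | clause a R σ V c π θ hc fresh mgu => exact ⟨θ, .clause a R V c π θ hc fresh mgu, rfl⟩
  | cmp r s t R σ V h => exact ⟨Subst.id, .cmp r s t R V h, (Subst.comp_id _).symm⟩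
  | is s t n R σ V θ h mgu => exact ⟨θ, .is s t n R V θ h mgu, rfl⟩

theorem Run.toDeriv {G G' : Goal Fs Ps} {V V' : Finset ℕ} {w : List (Option (Clause Fs Ps))}
    {τ : Subst Fs} (h : Run P G V w τ G' V') (σ : Subst Fs) :
    Deriv P ⟨G, σ, V⟩ w ⟨G', σ.comp τ, V'⟩ := by
  induction h generalizing σ with
  | nil G V => rw [Subst.comp_id]; exact .nil _
  | cons hs _ ih => rw [← Subst.comp_assoc]; exact .cons (hs.toStep σ) (ih _)

theorem Deriv.exists_run {C C' : Config Fs Ps} {w : List (Option (Clause Fs Ps))}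
    (h : Deriv P C w C') :
    ∃ τ, Run P C.goal C.used w τ C'.goal C'.used ∧ C'.answer = C.answer.comp τ := by
  induction h with
  | nil C => exact ⟨Subst.id, .nil _ _, (Subst.comp_id _).symm⟩
  | cons hs _ ih =>
    obtain ⟨θ, h1, h2⟩ := hs.exists_gStep
    obtain ⟨τ, h3, h4⟩ := ih
    exact ⟨θ.comp τ, .cons h1 h3, by rw [h4, h2, Subst.comp_assoc]⟩

theorem Run.trans {G G₁ G₂ : Goal Fs Ps} {V V₁ V₂ : Finset ℕ}
    {w w' : List (Option (Clause Fs Ps))} {τ τ' : Subst Fs} (h : Run P G V w τ G₁ V₁)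
    (h' : Run P G₁ V₁ w' τ' G₂ V₂) : Run P G V (w ++ w') (τ.comp τ') G₂ V₂ := by
  induction h with
  | nil => exact h'
  | cons hs _ ih => rw [Subst.comp_assoc]; exact .cons hs (ih h')

/-! ### Derivations in context -/

theorem GStep.append {G G' : Goal Fs Ps} {V V' : Finset ℕ} {l : Option (Clause Fs Ps)}
    {θ : Subst Fs} (h : GStep P G V l θ G' V') (R : Goal Fs Ps) :
    GStep P (G ++ R) V l θ (G' ++ goalSubst θ R) V' := by
  cases h with
  | clause a R' _ c π _ hc fresh mgu =>
    rw [← goalSubst_append, List.append_assoc]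
    exact .clause a (R' ++ R) V c π θ hc fresh mgu
  | cmp r s t _ _ h => rw [goalSubst_id]; exact .cmp r s t (G' ++ R) V h
  | is s t n R' _ _ h mgu =>
    rw [← goalSubst_append]
    exact .is s t n (R' ++ R) V θ h mgu

theorem Run.append {G G' : Goal Fs Ps} {V V' : Finset ℕ} {w : List (Option (Clause Fs Ps))}
    {τ : Subst Fs} (h : Run P G V w τ G' V') (R : Goal Fs Ps) :
    Run P (G ++ R) V w τ (G' ++ goalSubst τ R) V' := by
  induction h generalizing R with
  | nil G V => rw [goalSubst_id]; exact .nil _ _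
  | cons hs _ ih => rw [goalSubst_comp]; exact .cons (hs.append R) (ih _)

theorem GStep.of_append {A : Atom Fs Ps} {G H R : Goal Fs Ps} {V V' : Finset ℕ}
    {l : Option (Clause Fs Ps)} {θ : Subst Fs} (h : GStep P (A :: (G ++ R)) V l θ H V') :
    ∃ G', GStep P (A :: G) V l θ G' V' ∧ H = G' ++ goalSubst θ R := by
  cases h with
  | clause a _ _ c π _ hc fresh mgu =>
    refine ⟨_, .clause a G V c π θ hc fresh mgu, ?_⟩
    rw [← goalSubst_append, List.append_assoc]
  | cmp r s t _ _ h => exact ⟨G, .cmp r s t G V h, by rw [goalSubst_id]⟩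
  | is s t n _ _ _ h mgu => exact ⟨_, .is s t n G V θ h mgu, goalSubst_append _ _ _⟩

theorem GStep.mono {G G' : Goal Fs Ps} {V V' W : Finset ℕ} {l : Option (Clause Fs Ps)}
    {θ : Subst Fs} (h : GStep P G V l θ G' V') (hW : W ⊆ V) :
    ∃ W' ⊆ V', GStep P G W l θ G' W' := by
  cases h with
  | clause a R _ c π _ hc fresh mgu =>
    exact ⟨_, Finset.union_subset_union_left hW,
      .clause a R W c π θ hc (Finset.disjoint_of_subset_right hW fresh) mgu⟩
  | cmp r s t _ _ h => exact ⟨W, hW, .cmp r s t G' W h⟩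
  | is s t n R _ _ h mgu => exact ⟨W, hW, .is s t n R W θ h mgu⟩

/-- A derivation stays one if fewer variables are to be avoided. -/
theorem Run.mono {G G' : Goal Fs Ps} {V V' W : Finset ℕ} {w : List (Option (Clause Fs Ps))}
    {τ : Subst Fs} (h : Run P G V w τ G' V') (hW : W ⊆ V) :
    ∃ W' ⊆ V', Run P G W w τ G' W' := by
  induction h generalizing W with
  | nil G V => exact ⟨W, hW, .nil _ _⟩
  | cons hs _ ih =>
    obtain ⟨W₁, h1, h2⟩ := hs.mono hW
    obtain ⟨W₂, h3, h4⟩ := ih h1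
    exact ⟨W₂, h3, .cons h2 h4⟩

/-! ### The variables of a derivation -/

theorem unify_congr (a b : UserAtom Fs Ps) {τ τ' : Subst Fs}
    (h : ∀ x ∈ a.vars ∪ b.vars, τ x = τ' x) (hτ : a.subst τ = b.subst τ) :
    a.subst τ' = b.subst τ' := by
  rw [← (UserAtom.subst_eq_iff τ τ' a).2 fun x hx => h x (Finset.mem_union_left _ hx), hτ]
  exact (UserAtom.subst_eq_iff τ τ' b).2 fun x hx => h x (Finset.mem_union_right _ hx)

theorem unify_comp (a b : UserAtom Fs Ps) (τ δ : Subst Fs) (hτ : a.subst τ = b.subst τ) :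
    a.subst (τ.comp δ) = b.subst (τ.comp δ) := by
  rw [UserAtom.subst_comp, hτ, UserAtom.subst_comp]

theorem unifyInt_congr (s : Term Fs) (n : ℤ) {τ τ' : Subst Fs}
    (h : ∀ x ∈ s.vars, τ x = τ' x) (hτ : s.subst τ = .int n) : s.subst τ' = .int n := by
  rw [← (Term.subst_eq_iff τ τ' s).2 h, hτ]

theorem unifyInt_comp (s : Term Fs) (n : ℤ) (τ δ : Subst Fs) (hτ : s.subst τ = .int n) :
    s.subst (τ.comp δ) = .int n := by
  rw [Term.subst_comp, hτ]; rfl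

/-- The substitution computed by a step moves only variables of the selected atom and fresh ones,
and these are replaced by terms with such variables. -/
theorem GStep.vars {G G' : Goal Fs Ps} {V V' : Finset ℕ} {l : Option (Clause Fs Ps)}
    {θ : Subst Fs} (h : GStep P G V l θ G' V') (hG : goalVars G ⊆ V) :
    V ⊆ V' ∧ goalVars G' ⊆ V' ∧ ∀ x ∈ V, x ∉ goalVars G → θ x = .var x ∧ x ∉ goalVars G' := by
  cases h with
  | clause a R _ c π _ hc fresh mgu =>
    have hU := fun τ τ' => unify_congr a (c.rename π).head (τ := τ) (τ' := τ')
    have hUc := unify_comp a (c.rename π).head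
    have key : ∀ y, ∀ z ∈ (θ y).vars, z = y ∨ z ∈ a.vars ∪ (c.rename π).head.vars := by
      intro y z hz
      by_cases hy : y ∈ a.vars ∪ (c.rename π).head.vars
      · exact Or.inr (mgu.vars_subset hU hUc hy hz)
      · rw [mgu.eq_var hU hy] at hz
        exact Or.inl (by simpa [Term.vars] using hz)
    simp only [goalVars, Finset.union_subset_iff, Atom.vars] at hG
    have hhead : (c.rename π).head.vars ⊆ (c.rename π).vars := Finset.subset_union_left
    have hbody : goalVars (c.rename π).body ⊆ (c.rename π).vars := Finset.subset_union_right
    refine ⟨Finset.subset_union_left, ?_, ?_⟩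
    · intro z hz
      obtain ⟨y, hy, hz⟩ := (mem_goalVars_goalSubst _ _ _).1 hz
      rw [goalVars_append, Finset.mem_union] at hy
      rw [Finset.mem_union]
      rcases key y z hz with rfl | h
      · exact hy.elim (fun h => Or.inr (hbody h)) (fun h => Or.inl (hG.2 h))
      · exact (Finset.mem_union.1 h).elim (fun h => Or.inl (hG.1 h)) (fun h => Or.inr (hhead h))
    · intro x hxV hx
      simp only [goalVars, Finset.mem_union, not_or, Atom.vars] at hx
      have hxc : x ∉ (c.rename π).vars := fun h => Finset.disjoint_left.1 fresh h hxV
      have hxX : x ∉ a.vars ∪ (c.rename π).head.vars := fun h =>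
        (Finset.mem_union.1 h).elim hx.1 (fun h => hxc (hhead h))
      refine ⟨mgu.eq_var hU hxX, fun hz => ?_⟩
      obtain ⟨y, hy, hz⟩ := (mem_goalVars_goalSubst _ _ _).1 hz
      rw [goalVars_append, Finset.mem_union] at hy
      rcases key y x hz with rfl | h
      · exact hy.elim (fun h => hxc (hbody h)) hx.2
      · exact hxX h
  | cmp r s t _ _ h =>
    simp only [goalVars, Finset.union_subset_iff] at hG
    exact ⟨subset_rfl, hG.2, fun x _ hx => ⟨rfl, fun h => hx (Finset.mem_union_right _ h)⟩⟩
  | is s t n R _ _ h mgu =>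
    have hU := fun τ τ' => unifyInt_congr s n (τ := τ) (τ' := τ')
    have key : ∀ y, ∀ z ∈ (θ y).vars, z = y ∨ z ∈ s.vars := by
      intro y z hz
      by_cases hy : y ∈ s.vars
      · exact Or.inr (mgu.vars_subset hU (unifyInt_comp s n) hy hz)
      · rw [mgu.eq_var hU hy] at hz
        exact Or.inl (by simpa [Term.vars] using hz)
    simp only [goalVars, Finset.union_subset_iff, Atom.vars] at hG
    refine ⟨subset_rfl, ?_, ?_⟩
    · intro z hz
      obtain ⟨y, hy, hz⟩ := (mem_goalVars_goalSubst _ _ _).1 hz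
      rcases key y z hz with rfl | h
      · exact hG.2 hy
      · exact hG.1.1 h
    · intro x hxV hx
      simp only [goalVars, Finset.mem_union, not_or, Atom.vars] at hx
      refine ⟨mgu.eq_var hU hx.1.1, fun hz => ?_⟩
      obtain ⟨y, hy, hz⟩ := (mem_goalVars_goalSubst _ _ _).1 hz
      rcases key y x hz with rfl | h
      · exact hx.2 hy
      · exact hx.1.1 h

theorem Run.vars {G G' : Goal Fs Ps} {V V' : Finset ℕ} {w : List (Option (Clause Fs Ps))}
    {τ : Subst Fs} (h : Run P G V w τ G' V') (hG : goalVars G ⊆ V) :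
    V ⊆ V' ∧ goalVars G' ⊆ V' ∧ ∀ x ∈ V, x ∉ goalVars G → τ x = .var x := by
  induction h with
  | nil G V => exact ⟨subset_rfl, hG, fun _ _ _ => rfl⟩
  | cons hs _ ih =>
    obtain ⟨h1, h2, h3⟩ := hs.vars hG
    obtain ⟨h4, h5, h6⟩ := ih h2
    refine ⟨h1.trans h4, h5, fun x hxV hx => ?_⟩
    simp only [Subst.comp, (h3 x hxV hx).1, Term.subst, h6 x (h1 hxV) (h3 x hxV hx).2]

/-! ### The variant lemma -/

/-- A resolution step with a clause can be imitated on a variant of the query with any admissible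
renaming of the clause, and the resolvents are variants of each other. -/
theorem exists_variant_of_clause {a : UserAtom Fs Ps} {R : Goal Fs Ps} {V V' : Finset ℕ}
    {c : Clause Fs Ps} {ρ ρ' π : Equiv.Perm ℕ} {θ : Subst Fs}
    (fresh : Disjoint (c.rename ρ).vars V) (fresh' : Disjoint (c.rename ρ').vars V')
    (mgu : IsMGU (fun τ => a.subst τ = (c.rename ρ).head.subst τ) θ)
    (hV : goalVars (.user a :: R) ⊆ V)
    (hV' : goalVars (goalSubst (Subst.ofPerm π) (.user a :: R)) ⊆ V') :
    ∃ (θ' : Subst Fs) (π' : Equiv.Perm ℕ),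
      IsMGU (fun τ => (a.subst (Subst.ofPerm π)).subst τ = (c.rename ρ').head.subst τ) θ' ∧
      goalSubst θ' ((c.rename ρ').body ++ goalSubst (Subst.ofPerm π) R) =
        goalSubst (Subst.ofPerm π') (goalSubst θ ((c.rename ρ).body ++ R)) := by
  obtain ⟨π', h1, h2⟩ := exists_perm_merge (goalVars (.user a :: R)) (c.rename ρ).vars π
    (ρ.symm.trans ρ') (Finset.disjoint_of_subset_left hV fresh.symm) (by
      intro x hx y hy e
      obtain ⟨z, hz, rfl⟩ := (Clause.mem_vars_rename _ _ _).1 hy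
      refine Finset.disjoint_left.1 fresh' ((Clause.mem_vars_rename ρ' c _).2 ⟨z, hz, rfl⟩)
        (hV' ((mem_goalVars_ofPerm π _ _).2 ⟨x, hx, ?_⟩))
      rw [e]; simp)
  have h3 : ∀ x ∈ c.vars, π' (ρ x) = ρ' x := fun x hx => by
    rw [h2 _ ((Clause.mem_vars_rename _ _ _).2 ⟨x, hx, rfl⟩)]; simp
  have ha : a.subst (Subst.ofPerm π') = a.subst (Subst.ofPerm π) :=
    (UserAtom.subst_eq_iff _ _ _).2 fun x hx => by
      simp [Subst.ofPerm, h1 x (Finset.mem_union_left _ hx)]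
  have hR : goalSubst (Subst.ofPerm π') R = goalSubst (Subst.ofPerm π) R :=
    (goalSubst_eq_iff _ _ _).2 fun x hx => by
      simp [Subst.ofPerm, h1 x (Finset.mem_union_right _ hx)]
  have hh : (c.rename ρ).head.subst (Subst.ofPerm π') = (c.rename ρ').head := by
    simp only [Clause.rename]
    rw [← UserAtom.subst_comp, UserAtom.subst_eq_iff]
    exact fun x hx => congrArg Term.var (h3 x (Finset.mem_union_left _ hx))
  have hb : goalSubst (Subst.ofPerm π') (c.rename ρ).body = (c.rename ρ').body := by
    simp only [Clause.rename]
    rw [← goalSubst_comp, goalSubst_eq_iff]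
    exact fun x hx => congrArg Term.var (h3 x (Finset.mem_union_right _ hx))
  refine ⟨_, π', mgu.conj π' (fun τ => ?_) (unify_comp _ _), ?_⟩
  · rw [UserAtom.subst_comp, UserAtom.subst_comp, ha, hh]
  · rw [← hb, ← hR, ← goalSubst_append, ← goalSubst_comp, ← goalSubst_comp, Subst.comp_assoc,
      ← Subst.comp_assoc, Subst.ofPerm_comp_symm, Subst.id_comp]

theorem exists_variant_of_is {s : Term Fs} {n : ℤ} (R : Goal Fs Ps) (π : Equiv.Perm ℕ)
    {θ : Subst Fs} (mgu : IsMGU (fun τ => s.subst τ = .int n) θ) :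
    ∃ θ' : Subst Fs, IsMGU (fun τ => (s.subst (Subst.ofPerm π)).subst τ = .int n) θ' ∧
      goalSubst θ' (goalSubst (Subst.ofPerm π) R) =
        goalSubst (Subst.ofPerm π) (goalSubst θ R) := by
  refine ⟨_, mgu.conj π (fun τ => ?_) (unifyInt_comp _ _), ?_⟩
  · rw [Term.subst_comp]
  · rw [← goalSubst_comp, ← goalSubst_comp, Subst.comp_assoc,
      ← Subst.comp_assoc, Subst.ofPerm_comp_symm, Subst.id_comp]

theorem GStep.exists_variant {G G₁ : Goal Fs Ps} {V V₁ V' : Finset ℕ}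
    {l : Option (Clause Fs Ps)} {θ : Subst Fs} (h : GStep P G V l θ G₁ V₁) (π : Equiv.Perm ℕ)
    (hV : goalVars G ⊆ V) (hV' : goalVars (goalSubst (Subst.ofPerm π) G) ⊆ V') :
    ∃ (θ' : Subst Fs) (π' : Equiv.Perm ℕ) (V₁' : Finset ℕ),
      GStep P (goalSubst (Subst.ofPerm π) G) V' l θ' (goalSubst (Subst.ofPerm π') G₁) V₁' := by
  cases h with
  | clause a R _ c ρ _ hc fresh mgu =>
    obtain ⟨ρ', hρ'⟩ := exists_perm_fresh c.vars V'
    have fresh' : Disjoint (c.rename ρ').vars V' := Finset.disjoint_left.2 fun y hy => by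
      obtain ⟨x, hx, rfl⟩ := (Clause.mem_vars_rename _ _ _).1 hy
      exact hρ' x hx
    obtain ⟨θ', π', h1, h2⟩ := exists_variant_of_clause fresh fresh' mgu hV hV'
    refine ⟨θ', π', V' ∪ (c.rename ρ').vars, ?_⟩
    rw [← h2]
    exact .clause _ _ V' c ρ' θ' hc fresh' h1
  | cmp r s t _ _ h =>
    refine ⟨Subst.id, π, V', ?_⟩
    rw [goalSubst_cons, Atom.subst, (h.subst_eq _).1, (h.subst_eq _).2]
    exact .cmp r s t _ V' h
  | is s t n R _ _ h mgu =>
    obtain ⟨θ', h1, h2⟩ := exists_variant_of_is R π mgu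
    refine ⟨θ', π, V', ?_⟩
    rw [goalSubst_cons, Atom.subst, Term.subst_of_value h, ← h2]
    exact .is _ t n _ V' θ' h h1

/-- Steps from variants of a query with the same label lead to variants. -/
theorem GStep.unique {G G₁ G₁' : Goal Fs Ps} {V V₁ V' V₁' : Finset ℕ}
    {l : Option (Clause Fs Ps)} {θ θ' : Subst Fs} (h : GStep P G V l θ G₁ V₁)
    (h' : GStep P G V' l θ' G₁' V₁') (hV : goalVars G ⊆ V) (hV' : goalVars G ⊆ V') :
    ∃ π : Equiv.Perm ℕ, G₁' = goalSubst (Subst.ofPerm π) G₁ := by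
  cases h with
  | clause a R _ c ρ _ hc fresh mgu =>
    cases h' with
    | clause _ _ _ _ ρ' _ _ fresh' mgu' =>
      have hid : (Subst.ofPerm (Equiv.refl ℕ) : Subst Fs) = Subst.id := rfl
      obtain ⟨θ'', π', h1, h2⟩ := exists_variant_of_clause (π := Equiv.refl ℕ) fresh fresh' mgu hV
        (by rwa [hid, goalSubst_id])
      rw [hid, UserAtom.subst_id] at h1
      rw [hid, goalSubst_id] at h2
      obtain ⟨π'', h3⟩ := h1.exists_perm mgu' ((c.rename ρ').body ++ R)
      exact ⟨π'.trans π'', by rw [h3, h2, ← goalSubst_comp, Subst.ofPerm_comp]⟩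
  | cmp r s t _ _ h =>
    cases h' with
    | cmp => exact ⟨Equiv.refl ℕ, (goalSubst_id _).symm⟩
  | is s t n R _ _ h mgu =>
    cases h' with
    | is _ _ n' _ _ _ h' mgu' =>
      obtain rfl : n' = n := Option.some.inj (h'.symm.trans h)
      exact mgu.exists_perm mgu' R

theorem Run.exists_variant {G G₁ : Goal Fs Ps} {V V₁ V' : Finset ℕ}
    {w : List (Option (Clause Fs Ps))} {τ : Subst Fs} (h : Run P G V w τ G₁ V₁)
    (π : Equiv.Perm ℕ) (hV : goalVars G ⊆ V)
    (hV' : goalVars (goalSubst (Subst.ofPerm π) G) ⊆ V') :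
    ∃ τ' G₁' V₁', Run P (goalSubst (Subst.ofPerm π) G) V' w τ' G₁' V₁' := by
  induction h generalizing π V' with
  | nil G V => exact ⟨_, _, _, .nil _ _⟩
  | cons hs _ ih =>
    obtain ⟨θ', π', W, h1⟩ := hs.exists_variant π hV hV'
    obtain ⟨τ', G₁', V₁', h2⟩ := ih π' (hs.vars hV).2.1 (h1.vars hV').2.1
    exact ⟨_, _, _, .cons h1 h2⟩

/-- The label sequences of the derivations from a query; by the variant lemma they do not depend on
the variables to be avoided. -/
def words (P : Set (Clause Fs Ps)) (G : Goal Fs Ps) (V : Finset ℕ) :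
    Set (List (Option (Clause Fs Ps))) :=
  {w | ∃ τ G' V', Run P G V w τ G' V'}

theorem words_subset_variant {G : Goal Fs Ps} {V V' : Finset ℕ} (π : Equiv.Perm ℕ)
    (hV : goalVars G ⊆ V) (hV' : goalVars (goalSubst (Subst.ofPerm π) G) ⊆ V') :
    words P G V ⊆ words P (goalSubst (Subst.ofPerm π) G) V' := fun _ ⟨_, _, _, h⟩ =>
  h.exists_variant π hV hV'

theorem words_subset {G : Goal Fs Ps} {V V' : Finset ℕ}
    (hV : goalVars G ⊆ V) (hV' : goalVars G ⊆ V') : words P G V ⊆ words P G V' := by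
  have hid : (Subst.ofPerm (Equiv.refl ℕ) : Subst Fs) = Subst.id := rfl
  have := words_subset_variant (P := P) (V' := V') (Equiv.refl ℕ) hV (by rwa [hid, goalSubst_id])
  rwa [hid, goalSubst_id] at this

theorem ldTree_eq_words {G : Goal Fs Ps} : ldTree P G = words P G (goalVars G) := by
  ext w
  constructor
  · rintro ⟨C, h⟩
    obtain ⟨τ, h1, -⟩ := h.exists_run
    simp only [Config.init, Finset.empty_union] at h1
    exact ⟨_, _, _, h1⟩
  · rintro ⟨τ, G', V', h⟩
    refine ⟨⟨G', Subst.id.comp τ, V'⟩, ?_⟩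
    rw [Config.init, Finset.empty_union]
    exact h.toDeriv _

end

section
variable {Fs : Sig.{u}} {Ps : Sig.{v}}

/-! ### Termination implies acceptability -/

/-- A program whose LD-trees for the queries in `S` have bounded depth is acceptable with respect
to `S`: the depth of the LD-tree is a level mapping. -/
theorem acceptable_of_bounded (P : Set (Clause Fs Ps)) (S : Set (UserAtom Fs Ps))
    (hS : ∀ Q ∈ S, ∃ N, ∀ w ∈ ldTree P [.user Q], w.length ≤ N) : Acceptable P S := by
  have hvar : ∀ A B : Atom Fs Ps, Variant A B → ldTree P [A] ⊆ ldTree P [B] := by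
    rintro A B ⟨π, rfl⟩
    rw [ldTree_eq_words, ldTree_eq_words]
    exact words_subset_variant π subset_rfl subset_rfl
  have hsymm : ∀ A B : Atom Fs Ps, Variant A B → Variant B A := by
    rintro A B ⟨π, rfl⟩
    exact ⟨π.symm, by rw [← Atom.subst_comp, Subst.ofPerm_comp_symm, Atom.subst_id]⟩
  refine ⟨Quot.lift (fun A => sSup (List.length '' ldTree P [A])) (fun A B h => by
    rw [(hvar A B h).antisymm (hvar B A (hsymm A B h))]), ?_⟩
  rintro a ⟨Q, hQ, w₀, R, σ₀, V, hd⟩ c hc π hdisj θ mgu pre b post hbody - σ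
    ⟨w₁, τ, W, hd₁, hσ⟩
  obtain ⟨N, hN⟩ := hS Q hQ
  obtain ⟨τ₀, hrun, -⟩ := hd.exists_run
  simp only [Config.init, Finset.empty_union] at hrun
  have hbdd : ∀ w ∈ ldTree P [.user a], w.length ≤ N := by
    intro w hw
    rw [ldTree_eq_words] at hw
    have hVa : goalVars (.user a :: R) ⊆ V := (hrun.vars subset_rfl).2.1
    have hVa' : goalVars [Atom.user a] ⊆ V := by
      simp only [goalVars, Finset.union_empty]
      exact Finset.union_subset_left hVa
    obtain ⟨τ', G', V', h⟩ := words_subset subset_rfl hVa' hw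
    have := hN (w₀ ++ w) (by rw [ldTree_eq_words]; exact ⟨_, _, _, hrun.trans (h.append R)⟩)
    simp only [List.length_append] at this
    omega
  have hstep : GStep P [.user a] a.vars (some c) θ (goalSubst θ ((c.rename π).body ++ []))
      (a.vars ∪ (c.rename π).vars) := .clause a [] _ c π θ hc hdisj mgu
  have hsub := (hstep.vars (by simp [goalVars, Atom.vars])).2.1
  rw [List.append_nil, hbody] at hstep hsub
  rw [goalSubst_append, goalSubst_cons] at hstep hsub
  simp only [goalVars_append, goalVars, Finset.union_subset_iff] at hsub
  obtain ⟨τ₁, hrun₁, hτ₁⟩ := hd₁.exists_run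
  simp only [Config.init] at hrun₁ hτ₁
  obtain rfl : τ = τ₁ := hτ₁
  obtain ⟨W', -, hrun₁⟩ := hrun₁.mono (Finset.subset_union_left (s₁ := a.vars ∪ (c.rename π).vars))
  have hb : (b.subst θ).subst σ = (b.subst θ).subst τ := by
    rw [UserAtom.subst_eq_iff]
    intro x hx
    rw [hσ x]
    split_ifs with h
    · rfl
    · exact ((hrun₁.vars hsub.1).2.2 x (hsub.2.1 hx) h).symm
  have hrun₂ := hrun₁.append (.user (b.subst θ) :: goalSubst θ post)
  rw [List.nil_append, goalSubst_cons] at hrun₂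
  change sSup (List.length '' ldTree P [.user ((b.subst θ).subst σ)]) <
    sSup (List.length '' ldTree P [.user a])
  rw [hb]
  have hlong : ∀ w ∈ ldTree P [.user ((b.subst θ).subst τ)],
      (some c :: (w₁ ++ w)) ∈ ldTree P [.user a] := by
    intro w hw
    rw [ldTree_eq_words] at hw ⊢
    have hW' := (hrun₂.vars (by
      simp only [goalVars_append, goalVars, Finset.union_subset_iff]; exact hsub)).2.1
    obtain ⟨τ', G', V', h⟩ := words_subset (V' := W') subset_rfl (by
      simp only [goalVars, Finset.union_empty]
      exact Finset.union_subset_left hW') hw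
    have h1 := Run.cons hstep (hrun₂.trans (h.append (goalSubst τ (goalSubst θ post))))
    have hV : goalVars [Atom.user a] = a.vars := by simp [goalVars, Atom.vars]
    rw [hV]
    exact ⟨_, _, _, h1⟩
  have hbddA : BddAbove (List.length '' ldTree P [.user a]) :=
    ⟨N, by rintro _ ⟨w, hw, rfl⟩; exact hbdd w hw⟩
  have hlen : ∀ n ∈ List.length '' ldTree P [.user ((b.subst θ).subst τ)],
      n + 1 ≤ sSup (List.length '' ldTree P [.user a]) := by
    rintro _ ⟨w, hw, rfl⟩
    have := le_csSup hbddA ⟨_, hlong w hw, rfl⟩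
    simp only [List.length_cons, List.length_append] at this
    omega
  refine hlen _ (Nat.sSup_mem ⟨0, [], ⟨_, .nil _⟩, rfl⟩ ⟨_, fun n hn => (hlen n hn).trans' n.le_succ⟩)

/-! ### Erasing adornments -/

theorem UserAtom.erase_vars (a : UserAtom Fs Ps.adorn) : a.erase.vars = a.vars := rfl

theorem UserAtom.erase_subst (θ : Subst Fs) (a : UserAtom Fs Ps.adorn) :
    (a.subst θ).erase = a.erase.subst θ := rfl

theorem Atom.erase_vars (A : Atom Fs Ps.adorn) : A.erase.vars = A.vars := by cases A <;> rfl

theorem Atom.erase_subst (θ : Subst Fs) (A : Atom Fs Ps.adorn) :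
    (A.subst θ).erase = A.erase.subst θ := by cases A <;> rfl

theorem goalVars_map_erase (G : Goal Fs Ps.adorn) : goalVars (G.map Atom.erase) = goalVars G := by
  induction G with
  | nil => rfl
  | cons A G ih => simp [goalVars, ih, Atom.erase_vars]

theorem goalSubst_map_erase (θ : Subst Fs) (G : Goal Fs Ps.adorn) :
    (goalSubst θ G).map Atom.erase = goalSubst θ (G.map Atom.erase) := by
  simp [goalSubst, Atom.erase_subst]

theorem Clause.erase_vars (c : Clause Fs Ps.adorn) : c.erase.vars = c.vars := by
  simp [Clause.vars, Clause.erase, goalVars_map_erase, UserAtom.erase_vars]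

theorem Clause.erase_rename (π : Equiv.Perm ℕ) (c : Clause Fs Ps.adorn) :
    (c.rename π).erase = c.erase.rename π := by
  simp [Clause.rename, Clause.erase, goalSubst_map_erase, UserAtom.erase_subst]

theorem UserAtom.pred_eq_of_subst_eq {a b : UserAtom Fs Ps} {σ τ : Subst Fs}
    (h : a.subst σ = b.subst τ) : a.pred = b.pred := by
  have := congrArg UserAtom.pred h
  exact this

/-- Atoms with the same adorned predicate have the same unifiers as their erasures. -/
theorem unify_erase_iff {a b : UserAtom Fs Ps.adorn} (hp : a.pred = b.pred) (τ : Subst Fs) :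
    a.subst τ = b.subst τ ↔ a.erase.subst τ = b.erase.subst τ := by
  obtain ⟨p, s⟩ := a
  obtain ⟨q, t⟩ := b
  obtain rfl : p = q := hp
  constructor
  · exact fun h => congrArg UserAtom.erase h
  · intro h
    simp only [UserAtom.subst, UserAtom.erase, UserAtom.mk.injEq, heq_eq_eq, true_and] at h ⊢
    exact h

theorem isMGU_erase_iff {a b : UserAtom Fs Ps.adorn} (hp : a.pred = b.pred) (θ : Subst Fs) :
    IsMGU (fun τ => a.subst τ = b.subst τ) θ ↔
      IsMGU (fun τ => a.erase.subst τ = b.erase.subst τ) θ := by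
  simp only [unify_erase_iff hp]

theorem GStep.erase {P : Set (Clause Fs Ps)} {P' : Set (Clause Fs Ps.adorn)}
    (hP : ∀ c ∈ P', c.erase ∈ P) {G G' : Goal Fs Ps.adorn} {V V' : Finset ℕ}
    {l : Option (Clause Fs Ps.adorn)} {θ : Subst Fs} (h : GStep P' G V l θ G' V') :
    GStep P (G.map Atom.erase) V (l.map Clause.erase) θ (G'.map Atom.erase) V' := by
  cases h with
  | clause a R _ c π _ hc fresh mgu =>
    rw [goalSubst_map_erase, List.map_append]
    have hu : a.subst θ = (c.rename π).head.subst θ := mgu.unifies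
    have hp : a.pred = (c.rename π).head.pred := UserAtom.pred_eq_of_subst_eq hu
    have h1 := (isMGU_erase_iff hp θ).1 mgu
    have h2 : (c.rename π).head.erase = (c.erase.rename π).head := rfl
    have h3 : (c.rename π).body.map Atom.erase = (c.erase.rename π).body :=
      congrArg Clause.body (Clause.erase_rename π c)
    rw [h2] at h1
    rw [← Clause.erase_vars, Clause.erase_rename] at fresh ⊢
    rw [h3]
    exact .clause a.erase _ V c.erase π θ (hP c hc) fresh h1
  | cmp r s t _ _ h => exact .cmp r s t _ V h
  | is s t n R _ _ h mgu =>
    rw [goalSubst_map_erase]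
    exact .is s t n _ V θ h mgu

theorem Run.erase {P : Set (Clause Fs Ps)} {P' : Set (Clause Fs Ps.adorn)}
    (hP : ∀ c ∈ P', c.erase ∈ P) {G G' : Goal Fs Ps.adorn} {V V' : Finset ℕ}
    {w : List (Option (Clause Fs Ps.adorn))} {τ : Subst Fs} (h : Run P' G V w τ G' V') :
    Run P (G.map Atom.erase) V (w.map (Option.map Clause.erase)) τ (G'.map Atom.erase) V' := by
  induction h with
  | nil => exact .nil _ _
  | cons hs _ ih => exact .cons (hs.erase hP) ih

theorem length_le_of_erase {P : Set (Clause Fs Ps)} {P' : Set (Clause Fs Ps.adorn)}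
    (hP : ∀ c ∈ P', c.erase ∈ P) {Q : UserAtom Fs Ps.adorn} {N : ℕ}
    (hN : ∀ w ∈ ldTree P [.user Q.erase], w.length ≤ N) :
    ∀ w ∈ ldTree P' [.user Q], w.length ≤ N := by
  intro w hw
  rw [ldTree_eq_words] at hw
  obtain ⟨τ, G', V', h⟩ := hw
  have h1 := h.erase hP
  rw [← goalVars_map_erase] at h1
  have := hN _ (by rw [ldTree_eq_words]; exact ⟨_, _, _, h1⟩)
  simpa using this

/-! ### Strong normalisation -/

/-- There is no infinite derivation from the query in which the given variables are avoided. -/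
def SN (P : Set (Clause Fs Ps)) (G : Goal Fs Ps) (V : Finset ℕ) : Prop :=
  Acc (fun D C : Goal Fs Ps × Finset ℕ => ∃ l θ, GStep P C.1 C.2 l θ D.1 D.2) (G, V)

variable {P : Set (Clause Fs Ps)}

theorem SN.intro {G : Goal Fs Ps} {V : Finset ℕ}
    (h : ∀ l θ G' V', GStep P G V l θ G' V' → SN P G' V') : SN P G V :=
  Acc.intro _ fun ⟨G', V'⟩ ⟨l, θ, hs⟩ => h l θ G' V' hs

theorem SN.nil (V : Finset ℕ) : SN P [] V := SN.intro fun _ _ _ _ h => nomatch h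

theorem SN.append {G : Goal Fs Ps} {V : Finset ℕ} (h : SN P G V) (R : Goal Fs Ps)
    (hR : ∀ w τ V', Run P G V w τ [] V' → SN P (goalSubst τ R) V') : SN P (G ++ R) V := by
  unfold SN at h
  generalize hC : (G, V) = C at h
  induction h generalizing G V R with
  | intro C _ ih =>
    subst hC
    cases G with
    | nil => simpa [goalSubst_id] using hR _ _ _ (.nil _ _)
    | cons A G =>
      refine SN.intro fun l θ H V₁ hs => ?_
      obtain ⟨G', h1, rfl⟩ := hs.of_append
      refine ih (G', V₁) ⟨l, θ, h1⟩ _ (fun w τ V' hrun => ?_) rfl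
      rw [← goalSubst_comp]
      exact hR _ _ _ (.cons h1 hrun)

/-- König's lemma for LD-trees of finite programs: without infinite derivations the tree is
finite, since by the variant lemma there is, up to renaming, only one child for each label. -/
theorem SN.finite_words (hP : P.Finite) {G : Goal Fs Ps} {V : Finset ℕ} (h : SN P G V)
    (hV : goalVars G ⊆ V) : (words P G V).Finite := by
  unfold SN at h
  generalize hC : (G, V) = C at h
  induction h generalizing G V with
  | intro C _ ih =>
    subst hC
    have hlab : (insert none (some '' P)).Finite := (hP.image _).insert _
    have hfin : ∀ l, {w | ∃ θ G' V', GStep P G V l θ G' V' ∧ w ∈ words P G' V'}.Finite := by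
      intro l
      by_cases hl : ∃ θ G' V', GStep P G V l θ G' V'
      · obtain ⟨θ, G', V', hs⟩ := hl
        refine (ih (G', V') ⟨l, θ, hs⟩ (hs.vars hV).2.1 rfl).subset ?_
        rintro w ⟨θ₁, G₁, V₁, hs₁, hw⟩
        obtain ⟨π, rfl⟩ := hs₁.unique hs hV hV
        exact words_subset_variant π (hs₁.vars hV).2.1 (hs.vars hV).2.1 hw
      · exact Set.finite_empty.subset fun w ⟨θ, G', V', hs, _⟩ => hl ⟨θ, G', V', hs⟩
    refine ((hlab.biUnion fun l _ => (hfin l).image (List.cons l)).insert []).subset ?_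
    rintro w ⟨τ, G', V', hrun⟩
    cases hrun with
    | nil => exact Set.mem_insert _ _
    | @cons _ G₁ _ _ V₁ _ l w θ _ hs hrun =>
      refine Set.mem_insert_of_mem _ (Set.mem_biUnion (x := l) ?_
        ⟨w, ⟨θ, G₁, V₁, hs, _, _, _, hrun⟩, rfl⟩)
      cases hs with
      | clause a R _ c π _ hc fresh mgu => exact Or.inr ⟨c, hc, rfl⟩
      | cmp => exact Or.inl rfl
      | is => exact Or.inl rfl

end

section
variable {Fs : Sig.{u}} {Ps : Sig.{v}}

/-! ### Adornments that fit a derivation -/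

theorem SymExpr.eval_congr {n : ℕ} {z z' : Fin n → ℤ} (e : SymExpr n)
    (h : ∀ i ∈ e.positions, z i = z' i) : e.eval z = e.eval z' := by
  induction e with
  | int m => rfl
  | pos i => simp [SymExpr.eval, h i (by simp [SymExpr.positions])]
  | arith o e f he hf =>
    simp only [SymExpr.positions, Finset.mem_union] at h
    simp only [SymExpr.eval, he fun i hi => h i (Or.inl hi), hf fun i hi => h i (Or.inr hi)]

theorem SymCond.holds_congr {n : ℕ} {z z' : Fin n → ℤ} (c : SymCond n)
    (h : ∀ i ∈ c.positions, z i = z' i) : c.Holds z ↔ c.Holds z' := by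
  induction c with
  | true => rfl
  | false => rfl
  | ineq r e f =>
    simp only [SymCond.positions, Finset.mem_union] at h
    simp only [SymCond.Holds, e.eval_congr fun i hi => h i (Or.inl hi),
      f.eval_congr fun i hi => h i (Or.inr hi)]
  | not c hc => exact not_congr (hc h)
  | and c d hc hd =>
    simp only [SymCond.positions, Finset.mem_union] at h
    exact and_congr (hc fun i hi => h i (Or.inl hi)) (hd fun i hi => h i (Or.inr hi))
  | or c d hc hd =>
    simp only [SymCond.positions, Finset.mem_union] at h
    exact or_congr (hc fun i hi => h i (Or.inl hi)) (hd fun i hi => h i (Or.inr hi))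

/-- The adornment of the atom, if it has one, is compatible with the integers among the arguments
of the instance under `τ`. -/
def UserAtom.AdornmentFits (τ : Subst Fs) : UserAtom Fs Ps.adorn → Prop
  | ⟨.plain _, _⟩ => True
  | ⟨.adorned _ c, ts⟩ => ∃ z : Fin _ → ℤ, c.Holds z ∧ ∀ i n, (ts i).subst τ = .int n → z i = n

/-- The predicate of the atom may occur in the adorned program, and its adornment is compatible
with the integers among the arguments of the instance under `τ`. -/
def UserAtom.Fits (D : Set Ps.Sym) (𝒜 : (p : Ps.Sym) → Finset (SymCond (Ps.arity p)))
    (τ : Subst Fs) (a : UserAtom Fs Ps.adorn) : Prop :=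
  AdornedSym.Proper D 𝒜 a.pred ∧ a.AdornmentFits τ

variable {D : Set Ps.Sym} {𝒜 : (p : Ps.Sym) → Finset (SymCond (Ps.arity p))}

theorem UserAtom.fits_subst {θ τ : Subst Fs} {a : UserAtom Fs Ps.adorn} :
    (a.subst θ).Fits D 𝒜 τ ↔ a.Fits D 𝒜 (θ.comp τ) := by
  obtain ⟨p | ⟨p, c⟩, ts⟩ := a
  · rfl
  · simp only [UserAtom.Fits, UserAtom.AdornmentFits, UserAtom.subst, Term.subst_comp]

theorem UserAtom.Fits.of_comp {θ τ : Subst Fs} {a : UserAtom Fs Ps.adorn}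
    (h : a.Fits D 𝒜 (θ.comp τ)) : a.Fits D 𝒜 θ := by
  obtain ⟨p | ⟨p, c⟩, ts⟩ := a
  · exact h
  · obtain ⟨h1, z, h2, h3⟩ := h
    exact ⟨h1, z, h2, fun i n hi => h3 i n (by rw [Term.subst_comp, hi]; rfl)⟩

theorem UserAtom.Fits.id {τ : Subst Fs} {a : UserAtom Fs Ps.adorn} (h : a.Fits D 𝒜 τ) :
    a.Fits D 𝒜 Subst.id := by
  rw [← Subst.id_comp τ] at h
  exact h.of_comp

/-- If `ν` extends the integers among the values of `σ`, then an argument whose instance under `σ`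
is an integer has this integer as its value under `ν`. -/
theorem Term.eval_of_subst_eq_int {t : Term Fs} {σ : Subst Fs} {ν : ℕ → ℤ} {n : ℤ}
    (hν : ∀ x m, σ x = .int m → ν x = m) (h : t.subst σ = .int n) :
    t.eval (fun x => some (ν x)) = some n := by
  cases t with
  | var x => exact congrArg some (hν x n h)
  | int m => exact congrArg some (Term.int.inj h)
  | arith o s t => simp [Term.subst] at h
  | fn f ts => simp [Term.subst] at h

/-- Every atom has an adornment that fits and is satisfied under a given assignment. -/
theorem UserAtom.exists_fits (h𝒜 : ∀ p ∈ D, ∀ z, ∃ c ∈ 𝒜 p, c.Holds z) {τ : Subst Fs} {ν : ℕ → ℤ}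
    (hν : ∀ x m, τ x = .int m → ν x = m) (b : UserAtom Fs Ps) :
    ∃ b' : UserAtom Fs Ps.adorn, b'.erase = b ∧ b'.Fits D 𝒜 τ ∧ b'.AdornmentTrue ν := by
  by_cases hb : b.pred ∈ D
  · obtain ⟨c, hc, hz⟩ := h𝒜 b.pred hb fun i => ((b.args i).eval fun x => some (ν x)).getD 0
    refine ⟨⟨.adorned b.pred c, b.args⟩, rfl, ⟨⟨hb, hc⟩, _, hz, fun i n hi => ?_⟩, _,
      fun i m hi => ?_, hz⟩
    · simp [Term.eval_of_subst_eq_int hν hi]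
    · change ((b.args i).eval fun x => some (ν x)) = some m at hi
      simp [hi]
  · exact ⟨⟨.plain b.pred, b.args⟩, rfl, ⟨hb, trivial⟩, trivial⟩

theorem exists_fits_goal (h𝒜 : ∀ p ∈ D, ∀ z, ∃ c ∈ 𝒜 p, c.Holds z) {τ : Subst Fs} {ν : ℕ → ℤ}
    (hν : ∀ x m, τ x = .int m → ν x = m) (G : Goal Fs Ps) :
    ∃ G' : Goal Fs Ps.adorn, G'.map Atom.erase = G ∧
      ∀ b, Atom.user b ∈ G' → b.Fits D 𝒜 τ ∧ b.AdornmentTrue ν := by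
  induction G with
  | nil => exact ⟨[], rfl, by simp⟩
  | cons A G ih =>
    obtain ⟨G', h1, h2⟩ := ih
    cases A with
    | user b =>
      obtain ⟨b', rfl, h4⟩ := b.exists_fits h𝒜 hν
      refine ⟨.user b' :: G', by simp [h1, Atom.erase], fun b hb => ?_⟩
      rcases List.mem_cons.1 hb with h | h
      · cases h; exact h4
      · exact h2 b h
    | cmp r s t =>
      exact ⟨.cmp r s t :: G', by simp [h1, Atom.erase], fun b hb => h2 b (by simpa using hb)⟩
    | is s t =>
      exact ⟨.is s t :: G', by simp [h1, Atom.erase], fun b hb => h2 b (by simpa using hb)⟩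

/-- A clause head can be given the adornment of a call with which it unifies, provided that the
adornment refers only to arguments of the call that are integers; it is then satisfied under every
assignment that extends the integers among the values of the unifier. -/
theorem UserAtom.exists_head {a : UserAtom Fs Ps.adorn} {h : UserAtom Fs Ps}
    (ha : a.AdornmentFits Subst.id)
    (hint : ∀ p c ts, a = ⟨.adorned p c, ts⟩ → ∀ i ∈ c.positions, ∃ n : ℤ, ts i = .int n)
    {θ σ : Subst Fs} (hu : a.erase.subst θ = h.subst σ) {ν : ℕ → ℤ}
    (hν : ∀ x m, σ x = .int m → ν x = m) :
    ∃ h' : UserAtom Fs Ps.adorn, h'.pred = a.pred ∧ h'.erase = h ∧ h'.AdornmentTrue ν := by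
  obtain ⟨q, args⟩ := h
  obtain ⟨p | ⟨p, c⟩, ts⟩ := a
  · obtain rfl : p = q := UserAtom.pred_eq_of_subst_eq hu
    exact ⟨⟨.plain p, args⟩, rfl, rfl, trivial⟩
  · obtain rfl : p = q := UserAtom.pred_eq_of_subst_eq hu
    simp only [UserAtom.subst, UserAtom.erase, UserAtom.mk.injEq] at hu
    obtain ⟨z, hz, hfit⟩ := ha
    refine ⟨⟨.adorned p c, args⟩, rfl, rfl,
      fun i => ((args i).eval fun x => some (ν x)).getD 0, fun i m hi => ?_, ?_⟩
    · change ((args i).eval fun x => some (ν x)) = some m at hi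
      simp [hi]
    · refine (c.holds_congr fun i hi => ?_).1 hz
      obtain ⟨n, hn⟩ := hint p c ts rfl i hi
      have h1 : (args i).subst σ = .int n := by
        have := congrFun (eq_of_heq hu.2) i
        change (ts i).subst θ = (args i).subst σ at this
        rw [← this, hn]; rfl
      have h2 : (args i).eval (fun x => some (ν x)) = some n := Term.eval_of_subst_eq_int hν h1
      rw [hfit i n (by rw [hn]; rfl), h2]
      rfl

/-! ### The maximal prefix -/

theorem Atom.isPrefixAtom_erase (h : UserAtom Fs Ps.adorn) (B : Atom Fs Ps.adorn) :
    Atom.isPrefixAtom h.erase B.erase = Atom.isPrefixAtom h B := by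
  cases B <;> rfl

theorem Clause.maxPrefix_erase (c : Clause Fs Ps.adorn) :
    c.erase.maxPrefix = c.maxPrefix.map Atom.erase := by
  simp only [Clause.maxPrefix, Clause.erase, List.takeWhile_map]
  congr 2
  funext B
  exact Atom.isPrefixAtom_erase c.head B

theorem Atom.cmpTrue_erase {ν : ℕ → ℤ} {B : Atom Fs Ps.adorn} (h : B.erase.CmpTrue ν) :
    B.CmpTrue ν := by
  cases B <;> exact h

theorem takeWhile_isPrefixAtom_append (h b : UserAtom Fs Ps) (pre post : Goal Fs Ps) :
    (pre ++ .user b :: post).takeWhile (Atom.isPrefixAtom h) =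
      pre.takeWhile (Atom.isPrefixAtom h) := by
  induction pre with
  | nil => simp [Atom.isPrefixAtom]
  | cons B pre ih => simp only [List.cons_append, List.takeWhile_cons, ih]

variable {P : Set (Clause Fs Ps)}

/-- The comparisons at the beginning of a query that has a refutation hold. -/
theorem Run.cmpTrue_of_refutation (h : UserAtom Fs Ps) {σ : Subst Fs} {ν : ℕ → ℤ}
    (hν : ∀ x n, (σ x).value = some n → ν x = n) (G R : Goal Fs Ps) {V V' : Finset ℕ}
    {w : List (Option (Clause Fs Ps))} {τ : Subst Fs}
    (hrun : Run P (goalSubst σ G ++ R) V w τ [] V') :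
    ∀ B ∈ G.takeWhile (Atom.isPrefixAtom h), B.CmpTrue ν := by
  induction G generalizing V w τ with
  | nil => simp
  | cons A G ih =>
    cases A with
    | user a => simp [Atom.isPrefixAtom]
    | is s t => simp [Atom.isPrefixAtom]
    | cmp r s t =>
      cases hrun with
      | cons hs hrun =>
        cases hs with
        | cmp _ _ _ _ _ hr =>
          intro B hB
          rw [List.takeWhile_cons] at hB
          split_ifs at hB
          · rcases List.mem_cons.1 hB with rfl | hB
            · obtain ⟨m, n, h1, h2, h3⟩ := hr
              exact ⟨m, n, Term.eval_of_value_subst hν h1, Term.eval_of_value_subst hν h2, h3⟩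
            · exact ih hrun B hB
          · simp at hB

/-! ### Lifting derivations to the adorned program -/

/-- The adornments refer only to arguments that are integers in all calls. -/
def IntegerCalls (D : Set Ps.Sym) (𝒜 : (p : Ps.Sym) → Finset (SymCond (Ps.arity p)))
    (a : UserAtom Fs Ps) : Prop :=
  a.pred ∈ D → ∀ c ∈ 𝒜 a.pred, ∀ i ∈ c.positions, ∃ n : ℤ, a.args i = .int n

/-- A clause that is used for a call has an adorned version for the adorned call, if the comparisons
of its maximal prefix succeed. The assignment that witnesses consistency, and from which the
adornments of the body atoms are read off, consists of the values of the variables under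
`σ.comp τ`, where `σ` is the unifier and `τ` is computed by the rest of the derivation. -/
theorem exists_adorned_clause (h𝒜 : ∀ p ∈ D, ∀ z, ∃ c ∈ 𝒜 p, c.Holds z)
    {a : UserAtom Fs Ps.adorn} (ha : a.Fits D 𝒜 Subst.id) (hint : IntegerCalls D 𝒜 a.erase)
    {c : Clause Fs Ps} (hc : c ∈ P) {θ σ : Subst Fs} (hu : a.erase.subst θ = c.head.subst σ)
    (hpre : ∀ ν : ℕ → ℤ, (∀ x n, (σ x).value = some n → ν x = n) →
      ∀ B ∈ c.maxPrefix, B.CmpTrue ν) (τ : Subst Fs) :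
    ∃ c' ∈ adornedProgram P D 𝒜, c'.erase = c ∧ c'.head.pred = a.pred ∧
      ∀ b, Atom.user b ∈ c'.body → b.Fits D 𝒜 (σ.comp τ) := by
  have hν : ∀ x m, σ.comp τ x = .int m → (((σ.comp τ) x).value).getD 0 = m := by
    intro x m h; rw [h]; rfl
  have hν' : ∀ x n, (σ x).value = some n → (((σ.comp τ) x).value).getD 0 = n := by
    intro x n h
    rw [Subst.comp, Term.subst_of_value h, h]; rfl
  obtain ⟨body, hb1, hb2⟩ := exists_fits_goal h𝒜 hν c.body
  obtain ⟨head, hh1, hh2, hh3⟩ := UserAtom.exists_head (ν := fun x => (((σ.comp τ) x).value).getD 0)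
    ha.2 (by
      rintro p d ts rfl i hi
      exact hint ha.1.1 d ha.1.2 i hi) hu (fun x m h => hν' x m (by rw [h]; rfl))
  have he : (⟨head, body⟩ : Clause Fs Ps.adorn).erase = c := by
    rw [Clause.erase, hh2, hb1]
  refine ⟨⟨head, body⟩, ⟨by rwa [he], ?_, fun b hb => (hb2 b hb).1.1, ?_⟩, he, hh1,
    fun b hb => (hb2 b hb).1⟩
  · change AdornedSym.Proper D 𝒜 head.pred
    rw [hh1]; exact ha.1
  · refine ⟨_, fun B hB => Atom.cmpTrue_erase (hpre _ hν' B.erase ?_), hh3,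
      fun b hb => (hb2 b hb).2⟩
    rw [← he, Clause.maxPrefix_erase]
    exact List.mem_map_of_mem hB

theorem exists_of_user_mem_goalSubst {θ : Subst Fs} {G : Goal Fs Ps} {b : UserAtom Fs Ps}
    (h : .user b ∈ goalSubst θ G) : ∃ b₀, .user b₀ ∈ G ∧ b₀.subst θ = b := by
  obtain ⟨A, hA, hAb⟩ := List.mem_map.1 h
  cases A with
  | user b₀ => exact ⟨b₀, hA, Atom.user.inj hAb⟩
  | cmp r s t => simp [Atom.subst] at hAb
  | is s t => simp [Atom.subst] at hAb

theorem map_erase_eq_user_cons {G : Goal Fs Ps.adorn} {a : UserAtom Fs Ps} {R : Goal Fs Ps}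
    (h : G.map Atom.erase = .user a :: R) :
    ∃ a' R', G = .user a' :: R' ∧ a'.erase = a ∧ R'.map Atom.erase = R := by
  obtain ⟨A, R', rfl, hA, hR⟩ := List.map_eq_cons_iff.1 h
  cases A with
  | user a' => exact ⟨a', R', rfl, Atom.user.inj hA, hR⟩
  | cmp r s t => simp [Atom.erase] at hA
  | is s t => simp [Atom.erase] at hA

/-- The step of the adorned program with an adorned version of the clause. -/
theorem GStep.lift_clause {P' : Set (Clause Fs Ps.adorn)} {a : UserAtom Fs Ps.adorn}
    {c : Clause Fs Ps.adorn} (hc : c ∈ P') {ρ : Equiv.Perm ℕ} {θ : Subst Fs} {V : Finset ℕ}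
    (hp : c.head.pred = a.pred) (fresh : Disjoint (c.erase.rename ρ).vars V)
    (mgu : IsMGU (fun τ => a.erase.subst τ = (c.erase.rename ρ).head.subst τ) θ)
    (R : Goal Fs Ps.adorn) :
    IsMGU (fun τ => a.subst τ = (c.rename ρ).head.subst τ) θ ∧
    Disjoint (c.rename ρ).vars V ∧
    GStep P' (.user a :: R) V (some c) θ (goalSubst θ ((c.rename ρ).body ++ R))
      (V ∪ (c.erase.rename ρ).vars) := by
  have h1 := (isMGU_erase_iff (a := a) (b := (c.rename ρ).head) hp.symm θ).2 mgu
  rw [← Clause.erase_rename, Clause.erase_vars] at fresh ⊢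
  exact ⟨h1, fresh, .clause a R V c ρ θ hc fresh h1⟩

/-- A refutation is a refutation of the adorned program as well, if the atoms of the query carry
adornments that fit the computed answer. -/
theorem Run.lift (h𝒜 : ∀ p ∈ D, ∀ z, ∃ c ∈ 𝒜 p, c.Holds z) {G G₁ : Goal Fs Ps} {V V' : Finset ℕ}
    {w : List (Option (Clause Fs Ps))} {τ : Subst Fs} (hrun : Run P G V w τ G₁ V')
    (hnil : G₁ = []) (hcall : ∀ w₁ τ₁ a R V₁, Run P G V w₁ τ₁ (.user a :: R) V₁ →
      IntegerCalls D 𝒜 a) {G' : Goal Fs Ps.adorn} (hG' : G'.map Atom.erase = G)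
    (hfit : ∀ b, Atom.user b ∈ G' → b.Fits D 𝒜 τ) :
    ∃ w', Run (adornedProgram P D 𝒜) G' V w' τ [] V' := by
  induction hrun generalizing G' with
  | nil G V =>
    subst hnil
    obtain rfl := List.map_eq_nil_iff.1 hG'
    exact ⟨_, .nil _ _⟩
  | @cons G G₁ G₂ V V₁ V₂ l w θ τ hs hrun ih =>
    subst hnil
    have hcall₁ : ∀ w₁ τ₁ a R V₂, Run P G₁ V₁ w₁ τ₁ (.user a :: R) V₂ → IntegerCalls D 𝒜 a :=
      fun w₁ τ₁ a R V₂ h => hcall _ _ a R V₂ (.cons hs h)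
    cases hs with
    | clause a R _ c ρ _ hc fresh mgu =>
      obtain ⟨a, R, rfl, rfl, rfl⟩ := map_erase_eq_user_cons hG'
      have hu : a.erase.subst θ = c.head.subst ((Subst.ofPerm ρ).comp θ) := by
        rw [UserAtom.subst_comp]; exact mgu.unifies
      have hrun' := hrun
      rw [goalSubst_append, Clause.rename, ← goalSubst_comp] at hrun'
      obtain ⟨c, hc', rfl, hp, hbody⟩ := exists_adorned_clause h𝒜
        (hfit a (by simp)).id (hcall _ _ _ _ _ (.nil _ _)) hc hu
        (fun ν hν => hrun'.cmpTrue_of_refutation c.head hν) τ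
      obtain ⟨-, -, hs'⟩ := GStep.lift_clause hc' hp fresh mgu R
      obtain ⟨w', h⟩ := ih rfl hcall₁ (G' := goalSubst θ ((c.rename ρ).body ++ R)) (by
        rw [goalSubst_map_erase, List.map_append, ← Clause.erase_rename]; rfl) (by
        intro b hb
        obtain ⟨b₀, hb₀, rfl⟩ := exists_of_user_mem_goalSubst hb
        rw [UserAtom.fits_subst]
        rcases List.mem_append.1 hb₀ with h | h
        · obtain ⟨b₁, hb₁, rfl⟩ := exists_of_user_mem_goalSubst h
          rw [UserAtom.fits_subst, ← Subst.comp_assoc]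
          exact hbody b₁ hb₁
        · exact hfit b₀ (List.mem_cons_of_mem _ h))
      exact ⟨_, .cons hs' h⟩
    | cmp r s t _ _ h =>
      obtain ⟨A, R, rfl, hA, rfl⟩ := List.map_eq_cons_iff.1 hG'
      obtain rfl : A = .cmp r s t := by cases A <;> simp_all [Atom.erase]
      obtain ⟨w', h'⟩ := ih rfl hcall₁ (G' := R) rfl
        (fun b hb => hfit b (List.mem_cons_of_mem _ hb))
      exact ⟨_, .cons (.cmp r s t R V h) h'⟩
    | is s t n R _ _ h mgu =>
      obtain ⟨A, R, rfl, hA, rfl⟩ := List.map_eq_cons_iff.1 hG'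
      obtain rfl : A = .is s t := by cases A <;> simp_all [Atom.erase]
      obtain ⟨w', h'⟩ := ih rfl hcall₁ (G' := goalSubst θ R) (goalSubst_map_erase _ _) (by
        intro b hb
        obtain ⟨b₀, hb₀, rfl⟩ := exists_of_user_mem_goalSubst hb
        rw [UserAtom.fits_subst]
        exact hfit b₀ (List.mem_cons_of_mem _ hb₀))
      exact ⟨_, .cons (.is s t n R V θ h mgu) h'⟩

end

section
variable {Fs : Sig.{u}} {Ps : Sig.{v}}

/-! ### The dependency order of a finite program -/

/-- The number of predicates on which a predicate depends; it decreases when dependency is strict. -/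
noncomputable def dependencyRank (P : Set (Clause Fs Ps)) (p : Ps.Sym) : ℕ :=
  {q | DependsOn P p q}.ncard

theorem dependencyRank_le {P : Set (Clause Fs Ps)} {p q : Ps.Sym}
    (hfin : {r | DependsOn P p r}.Finite) (h : DependsOn P p q) :
    dependencyRank P q ≤ dependencyRank P p :=
  Set.ncard_le_ncard (fun _ hr => h.trans hr) hfin

theorem dependencyRank_lt {P : Set (Clause Fs Ps)} {p q : Ps.Sym}
    (hfin : {r | DependsOn P p r}.Finite) (h : DependsOn P p q) (h' : ¬ DependsOn P q p) :
    dependencyRank P q < dependencyRank P p :=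
  Set.ncard_lt_ncard ⟨fun _ hr => h.trans hr, fun hsub => h' (hsub Relation.ReflTransGen.refl)⟩
    hfin

theorem finite_dependsOn_adornedProgram {P : Set (Clause Fs Ps)} (hP : P.Finite)
    (D : Set Ps.Sym) (𝒜 : (p : Ps.Sym) → Finset (SymCond (Ps.arity p))) (p : AdornedSym Ps) :
    {q | DependsOn (Ps := Ps.adorn) (adornedProgram P D 𝒜) p q}.Finite := by
  have h1 : {q | ∃ c ∈ P, ∃ A ∈ c.body, ∃ b : UserAtom Fs Ps, A = .user b ∧ b.pred = q}.Finite := by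
    refine (hP.biUnion fun c _ => c.body.finite_toSet.biUnion
      (t := fun A => {q | ∃ b : UserAtom Fs Ps, A = .user b ∧ b.pred = q}) fun A _ =>
        Set.Subsingleton.finite ?_).subset ?_
    · rintro q ⟨b, rfl, rfl⟩ r ⟨b', h, rfl⟩
      rw [Atom.user.inj h]
    · rintro q ⟨c, hc, A, hA, h⟩
      exact Set.mem_biUnion hc (Set.mem_biUnion hA h)
  refine ((h1.biUnion fun q _ => (((𝒜 q).finite_toSet.image (AdornedSym.adorned q)).insert
    (AdornedSym.plain q))).insert p).subset ?_
  intro q hq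
  rcases Relation.ReflTransGen.cases_tail hq with rfl | ⟨r, -, c, hc, -, b, hb, rfl⟩
  · exact Set.mem_insert _ _
  · refine Set.mem_insert_of_mem _ (Set.mem_biUnion (x := AdornedSym.base b.pred)
      ⟨c.erase, hc.1, .user b.erase, List.mem_map_of_mem (f := Atom.erase) hb, _, rfl, rfl⟩ ?_)
    have := hc.2.2.1 b hb
    obtain ⟨q | ⟨q, d⟩, ts⟩ := b
    · exact Set.mem_insert _ _
    · exact Set.mem_insert_of_mem _ ⟨d, this.2, rfl⟩

/-! ### Acceptability of the adorned program implies termination -/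

variable {P : Set (Clause Fs Ps)} {S : Set (UserAtom Fs Ps)} {D : Set Ps.Sym}
  {𝒜 : (p : Ps.Sym) → Finset (SymCond (Ps.arity p))}

/-- Every call that arises directly from a call, by resolving it with a clause and refuting the
atoms to the left of the new call, has an adorned version that arises in the same way in the adorned
program. -/
theorem exists_adorned_call (h𝒜 : ∀ p ∈ D, ∀ z, ∃ c ∈ 𝒜 p, c.Holds z)
    {a : UserAtom Fs Ps.adorn} (ha : a.Fits D 𝒜 Subst.id) {R : Goal Fs Ps.adorn} {V V' : Finset ℕ}
    (hcall : ∀ w₁ τ₁ b R₁ V₁, Run P (.user a.erase :: R.map Atom.erase) V w₁ τ₁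
      (.user b :: R₁) V₁ → IntegerCalls D 𝒜 b)
    {c : Clause Fs Ps} (hc : c ∈ P) {ρ : Equiv.Perm ℕ} {θ : Subst Fs}
    (fresh : Disjoint (c.rename ρ).vars V)
    (mgu : IsMGU (fun τ => a.erase.subst τ = (c.rename ρ).head.subst τ) θ)
    {pre post : Goal Fs Ps} {b : UserAtom Fs Ps} (hbody : c.body = pre ++ .user b :: post)
    {w : List (Option (Clause Fs Ps))} {τ : Subst Fs}
    (hrun : Run P (goalSubst θ (goalSubst (Subst.ofPerm ρ) pre)) (V ∪ (c.rename ρ).vars) w τ [] V') :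
    ∃ c' ∈ adornedProgram P D 𝒜, Disjoint (c'.rename ρ).vars V ∧
      IsMGU (fun τ => a.subst τ = (c'.rename ρ).head.subst τ) θ ∧
      c'.head.pred = a.pred ∧
      ∃ (pre' post' : Goal Fs Ps.adorn) (b' : UserAtom Fs Ps.adorn),
        c'.body = pre' ++ .user b' :: post' ∧ b'.erase = b ∧
        b'.Fits D 𝒜 (((Subst.ofPerm ρ).comp θ).comp τ) ∧
        ∃ w' w'' τ'' R',
          Run (adornedProgram P D 𝒜) (goalSubst θ (goalSubst (Subst.ofPerm ρ) pre'))
            (V ∪ (c'.rename ρ).vars) w' τ [] V' ∧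
          Run (adornedProgram P D 𝒜) (.user a :: R) V w'' τ''
            (.user (((b'.subst (Subst.ofPerm ρ)).subst θ).subst τ) :: R') V' := by
  have hu : a.erase.subst θ = c.head.subst ((Subst.ofPerm ρ).comp θ) := by
    rw [UserAtom.subst_comp]; exact mgu.unifies
  have hpre : ∀ ν : ℕ → ℤ, (∀ x n, (((Subst.ofPerm ρ).comp θ) x).value = some n → ν x = n) →
      ∀ B ∈ c.maxPrefix, B.CmpTrue ν := by
    intro ν hν
    rw [Clause.maxPrefix, hbody, takeWhile_isPrefixAtom_append]
    have h := hrun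
    rw [← goalSubst_comp, ← List.append_nil (goalSubst _ pre)] at h
    exact h.cmpTrue_of_refutation c.head hν
  have hstep : GStep P (.user a.erase :: R.map Atom.erase) V (some c) θ
      (goalSubst θ ((c.rename ρ).body ++ R.map Atom.erase)) (V ∪ (c.rename ρ).vars) :=
    .clause a.erase _ V c ρ θ hc fresh mgu
  obtain ⟨c, hc', rfl, hp, hfit⟩ := exists_adorned_clause h𝒜 ha
    (hcall _ _ _ _ _ (.nil _ _)) hc hu hpre τ
  obtain ⟨mgu', fresh', hs'⟩ := GStep.lift_clause hc' hp fresh mgu R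
  obtain ⟨pre', l, hl, rfl, hl'⟩ := List.map_eq_append_iff.1 hbody
  obtain ⟨b', post', rfl, rfl, rfl⟩ := map_erase_eq_user_cons hl'
  rw [← Clause.erase_rename, Clause.erase_vars] at hrun hstep hs'
  have hb1 : (c.rename ρ).body = goalSubst (Subst.ofPerm ρ) pre' ++
      .user (b'.subst (Subst.ofPerm ρ)) :: goalSubst (Subst.ofPerm ρ) post' := by
    rw [Clause.rename, hl, goalSubst_append]; rfl
  have hb2 : (c.rename ρ).erase.body = goalSubst (Subst.ofPerm ρ) (pre'.map Atom.erase) ++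
      .user (b'.erase.subst (Subst.ofPerm ρ)) ::
        goalSubst (Subst.ofPerm ρ) (post'.map Atom.erase) := by
    simp only [Clause.erase, hb1, List.map_append, List.map_cons, goalSubst_map_erase,
      Atom.erase, UserAtom.erase_subst]
  rw [hb2, List.append_assoc, goalSubst_append] at hstep
  rw [hb1, List.append_assoc, goalSubst_append] at hs'
  obtain ⟨w', h⟩ := Run.lift h𝒜 hrun rfl
    (fun w₁ τ₁ b₁ R₁ V₁ h => hcall _ _ b₁ _ V₁ (.cons hstep (h.append _)))
    (G' := goalSubst θ (goalSubst (Subst.ofPerm ρ) pre'))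
    (by rw [goalSubst_map_erase, goalSubst_map_erase]) (by
      intro b₀ hb₀
      obtain ⟨b₁, hb₁, rfl⟩ := exists_of_user_mem_goalSubst hb₀
      obtain ⟨b₂, hb₂, rfl⟩ := exists_of_user_mem_goalSubst hb₁
      rw [UserAtom.fits_subst, UserAtom.fits_subst, ← Subst.comp_assoc]
      exact hfit b₂ (by rw [hl]; exact List.mem_append_left _ hb₂))
  exact ⟨c, hc', fresh', mgu', hp, pre', post', b', hl, rfl, hfit b' (by rw [hl]; simp),
    w', _, _, _, h, .cons hs' (h.append _)⟩

/-- The computed answer of a prefix of a clause body, in the form required by acceptability. -/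
theorem Run.exists_isComputedAnswer {G : Goal Fs Ps} {V V' W : Finset ℕ}
    {w : List (Option (Clause Fs Ps))} {τ : Subst Fs} (h : Run P G V w τ [] V') (hW : W ⊆ V)
    (hG : goalVars G ⊆ V) :
    ∃ σ, IsComputedAnswer P W G σ ∧
      ∀ b : UserAtom Fs Ps, b.vars ⊆ V → b.subst σ = b.subst τ := by
  classical
  obtain ⟨W', -, h'⟩ := h.mono (Finset.union_subset hW hG)
  refine ⟨fun x => if x ∈ goalVars G then τ x else .var x,
    ⟨w, Subst.id.comp τ, W', h'.toDeriv _, fun x => rfl⟩, fun b hb => ?_⟩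
  rw [UserAtom.subst_eq_iff]
  intro x hx
  split_ifs with hxG
  · rfl
  · exact ((h.vars hG).2.2 x (hb hx) hxG).symm

theorem Run.mem_call {S : Set (UserAtom Fs Ps)} {Q : UserAtom Fs Ps} (hQ : Q ∈ S) {A : Atom Fs Ps}
    {R : Goal Fs Ps} {V : Finset ℕ} {w : List (Option (Clause Fs Ps))} {τ : Subst Fs}
    (h : Run P [.user Q] Q.vars w τ (A :: R) V) : A ∈ Call P S := by
  have hinit : (Config.init [Atom.user Q] ∅ : Config Fs Ps) =
      ⟨[.user Q], Subst.id, Q.vars⟩ := by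
    simp [Config.init, goalVars, Atom.vars]
    rfl
  exact ⟨Q, hQ, w, R, Subst.id.comp τ, V, hinit ▸ h.toDeriv _⟩

/-- A query all of whose atoms terminate when they are called terminates. -/
theorem SN.of_body (G : Goal Fs Ps) {V : Finset ℕ}
    (h : ∀ pre b post, G = pre ++ .user b :: post → ∀ w τ V', Run P pre V w τ [] V' →
      SN P [.user (b.subst τ)] V') : SN P G V := by
  have key : ∀ rest pre, G = pre ++ rest → ∀ w τ V', Run P pre V w τ [] V' →
      SN P (goalSubst τ rest) V' := by
    intro rest
    induction rest with
    | nil => exact fun _ _ _ _ V' _ => SN.nil V'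
    | cons A rest ih =>
      intro pre hG w τ V' hrun
      rw [goalSubst_cons]
      refine SN.append (G := [A.subst τ]) ?_ (goalSubst τ rest) (fun w' τ' V'' hrun' => ?_)
      · cases A with
        | user b => exact h pre b rest hG w τ V' hrun
        | cmp r s t =>
          refine SN.intro fun l θ G' V₁ hs => ?_
          cases hs with
          | cmp => exact SN.nil _
        | is s t =>
          refine SN.intro fun l θ G' V₁ hs => ?_
          cases hs with
          | is => exact SN.nil _
      · rw [← goalSubst_comp]
        refine ih (pre ++ [A]) (by rw [hG]; simp) (w ++ w') _ V'' ?_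
        exact (hrun.append [A]).trans hrun'
  simpa [goalSubst_id] using key G [] rfl [] Subst.id V (.nil _ _)

/-- If the adorned program is acceptable, then every call with a fitting adornment has only finite
derivations in the original program, by induction on the dependency order and the level mapping of
the adorned program. -/
theorem SN.of_acceptable (hP : P.Finite) (h𝒜 : ∀ p ∈ D, ∀ z, ∃ c ∈ 𝒜 p, c.Holds z)
    (hint : ∀ a, Atom.user a ∈ Call P S → IntegerCalls D 𝒜 a)
    {S' : Set (UserAtom Fs Ps.adorn)} (hS : ∀ Q ∈ S', Q.erase ∈ S)
    (hacc : Acceptable (adornedProgram P D 𝒜) S') {Q : UserAtom Fs Ps.adorn} (hQ : Q ∈ S')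
    (hfit : Q.Fits D 𝒜 Subst.id) : SN P [.user Q.erase] Q.vars := by
  obtain ⟨level, hlevel⟩ := hacc
  have hsub : ∀ c ∈ adornedProgram P D 𝒜, c.erase ∈ P := fun c hc => hc.1
  suffices key : ∀ r n : ℕ, ∀ (a : UserAtom Fs Ps.adorn) R V w τ,
      Run (adornedProgram P D 𝒜) [.user Q] Q.vars w τ (.user a :: R) V →
      a.Fits D 𝒜 Subst.id → dependencyRank (adornedProgram P D 𝒜) a.pred = r →
      level (Quot.mk _ (.user a)) = n → SN P [.user a.erase] V by
    exact key _ _ Q [] Q.vars [] _ (.nil _ _) hfit rfl rfl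
  intro r
  induction r using Nat.strong_induction_on with
  | _ r ihr =>
  intro n
  induction n using Nat.strong_induction_on with
  | _ n ihn =>
  intro a R V w τ hrun ha hr hn
  have hQV : goalVars [Atom.user Q] ⊆ Q.vars := by simp [goalVars, Atom.vars]
  have hV : a.vars ⊆ V := Finset.union_subset_left (hrun.vars hQV).2.1
  have hcalla := hrun.mem_call hQ
  refine SN.intro fun l θ G V₁ hs => ?_
  cases hs with
  | clause _ _ _ c ρ _ hc fresh mgu =>
    rw [List.append_nil]
    refine SN.of_body _ fun pre b post hbody w₁ τ₁ V' hrun₁ => ?_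
    rw [Clause.rename, ← goalSubst_comp] at hbody
    obtain ⟨pre₀, l, hbody₀, rfl, hl⟩ := List.map_eq_append_iff.1 hbody
    obtain ⟨B, post₀, rfl, hB, rfl⟩ := List.map_eq_cons_iff.1 hl
    obtain ⟨b₀, rfl, rfl⟩ : ∃ b₀, B = .user b₀ ∧ b₀.subst ((Subst.ofPerm ρ).comp θ) = b := by
      cases B with
      | user b₀ => exact ⟨b₀, rfl, Atom.user.inj hB⟩
      | cmp r s t => simp [Atom.subst] at hB
      | is s t => simp [Atom.subst] at hB
    change Run P (goalSubst ((Subst.ofPerm ρ).comp θ) pre₀) _ _ _ _ _ at hrun₁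
    rw [goalSubst_comp] at hrun₁
    obtain ⟨c', hc', fresh', mgu', hp, pre', post', b', hbody', rfl, hfit', w', w'', τ'', R',
      hpre', hnext⟩ := exists_adorned_call h𝒜 ha (R := R) (by
        intro w₂ τ₂ b R₂ V₂ h
        exact hint b (((hrun.erase hsub).trans h).mem_call (hS Q hQ))) hc fresh mgu hbody₀ hrun₁
    have hstep' : GStep (adornedProgram P D 𝒜) [.user a] V (some c') θ
        (goalSubst θ ((c'.rename ρ).body ++ [])) (V ∪ (c'.rename ρ).vars) :=
      .clause a [] V c' ρ θ hc' fresh' mgu'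
    have hbodyρ : (c'.rename ρ).body = goalSubst (Subst.ofPerm ρ) pre' ++
        .user (b'.subst (Subst.ofPerm ρ)) :: goalSubst (Subst.ofPerm ρ) post' := by
      rw [Clause.rename, hbody', goalSubst_append]; rfl
    have hvars' := (hstep'.vars (by simpa [goalVars, Atom.vars] using hV)).2.1
    rw [List.append_nil, hbodyρ, goalSubst_append, goalSubst_cons, goalVars_append, goalVars,
      Finset.union_subset_iff, Finset.union_subset_iff] at hvars'
    obtain ⟨σ, hσ, hσb⟩ := hpre'.exists_isComputedAnswer
      (Finset.union_subset_union_left (t := (c'.rename ρ).vars) hV) hvars'.1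
    have hrun' := hrun.trans hnext
    have hfit'' : (((b'.subst (Subst.ofPerm ρ)).subst θ).subst τ₁).Fits D 𝒜 Subst.id := by
      rw [UserAtom.fits_subst, UserAtom.fits_subst, UserAtom.fits_subst, Subst.comp_id,
        ← Subst.comp_assoc]
      exact hfit'
    have hdep : DependsOn (adornedProgram P D 𝒜) a.pred b'.pred :=
      .single ⟨c', hc', hp, b', by rw [hbody']; simp, rfl⟩
    have hfin := finite_dependsOn_adornedProgram hP D 𝒜
    rw [UserAtom.subst_comp]
    by_cases hdep' : DependsOn (adornedProgram P D 𝒜) b'.pred a.pred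
    · have hlt := hlevel a hcalla c' hc' ρ (Finset.disjoint_of_subset_right hV fresh') θ mgu' _ _ _
        hbodyρ ⟨hdep', hdep⟩ σ hσ
      rw [hσb _ hvars'.2.1] at hlt
      exact ihn _ (hn ▸ hlt) _ R' V' _ _ hrun' hfit''
        (((dependencyRank_le (hfin _) hdep).antisymm (dependencyRank_le (hfin _) hdep')).trans hr)
        rfl
    · exact ihr _ (hr ▸ dependencyRank_lt (hfin _) hdep hdep') _ _ R' V' _ _ hrun' hfit'' rfl rfl

end
end LP

theorem mainTheorem2 {Fs : LP.Sig.{u}} {Ps : LP.Sig.{v}}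
    (P : Set (LP.Clause Fs Ps)) (hP : P.Finite)
    (S : Set (LP.UserAtom Fs Ps))
    (𝒜 : (p : Ps.Sym) → Finset (LP.SymCond (Ps.arity p)))
    (h𝒜 : ∀ p ∈ LP.AdornedPreds P S, LP.IsAdornmentSet P S p (𝒜 p)) :
    (∀ Q ∈ S, LP.LDTerminates P [.user Q]) ↔
      LP.Acceptable (LP.adornedProgram P (LP.AdornedPreds P S) 𝒜) (LP.adornedQueries S 𝒜) := by
  constructor
  · intro hT
    refine LP.acceptable_of_bounded _ _ ?_
    rintro _ ⟨Q, hQ, A, -, rfl⟩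
    obtain ⟨N, hN⟩ := ((hT Q hQ).image List.length).bddAbove
    exact ⟨N, LP.length_le_of_erase (fun c hc => hc.1) fun w hw => hN ⟨w, hw, rfl⟩⟩
  · intro hacc Q hQ
    have hD : Q.pred ∈ LP.AdornedPreds P S := ⟨Q, hQ, .refl, .refl⟩
    obtain ⟨A, hA, hz⟩ := (h𝒜 _ hD).cover fun i => ((Q.args i).value).getD 0
    have hSN := LP.SN.of_acceptable (S' := LP.adornedQueries S 𝒜) hP
      (fun p hp => (h𝒜 p hp).cover)
      (fun a ha hp c hc i hi => (h𝒜 a.pred hp).integer_positions c hc i hi a.args ha)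
      (by rintro _ ⟨Q, hQ, A, -, rfl⟩; exact hQ) hacc
      (Q := ⟨.adorned Q.pred A, Q.args⟩) ⟨Q, hQ, A, hA, rfl⟩
      ⟨⟨hD, hA⟩, _, hz, fun i n hi => by
        change (Q.args i).subst LP.Subst.id = .int n at hi
        rw [LP.Term.subst_id] at hi
        rw [hi]; rfl⟩
    have hV : LP.goalVars [LP.Atom.user Q] = Q.vars := by simp [LP.goalVars, LP.Atom.vars]
    rw [LP.LDTerminates, LP.ldTree_eq_words]
    exact LP.SN.finite_words hP (hV ▸ hSN) subset_rfl
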